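/- Let $P_1,P_2,P_3>0$, $\beta>0$, $\lambda_1\ge 0$, $\lambda_3>0$, $\lambda_{p_2}>0$, $\bar m>0$, $\sigma>0$. On a probability space let $\Phi_1,\Phi_2,\Phi_3$ be independent point processes in $\mathbb{R}^2$ such that $\Phi_1$ and $\Phi_3$ are homogeneous Poisson processes of intensities $\lambda_1$ and $\lambda_3$, and $\Phi_2$ is a Thomas cluster process: $\Phi_2=\bigcup_k (X_k+\Psi_k)$, where the parents $\{X_k\}$ form a homogeneous Poisson process of intensity $\lambda_{p_2}$ and the clusters $\Psi_k$ are i.i.d. Poisson processes, independent of the parents, with intensity function $\bar m\, e^{-\|y\|^2/(2\sigma^2)}/(2\pi\sigma^2)$. Let $R_i=\min_{x\in\Phi_i}\|x\|$ (with $R_i=\infty$ and $R_i^{-\beta}=0$ if $\Phi_i$ is empty) be the distance from the typical user at the origin to the closest node of tier $i$, let $$\mathcal{S}_i=\Big\{P_iR_i^{-\beta}>\max_{n\ne i}P_nR_n^{-\beta}\Big\}$$ be the event that the typical user associates with tier $i$, and let $\mathcal{G}_{3,i}=\mathbb{P}(\mathcal{S}_i)$. Put $$I_0(z)=\frac1\pi\int_0^\pi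 e^{z\cos\phi}\,d\phi,\qquad q(a,b)=b\,e^{-(a^2+b^2)/2}I_0(ab),\qquad Q_1(a,b)=\int_b^\infty z\,e^{-(z^2+a^2)/2}I_0(az)\,dz,$$ $\tau_i(r)=2\pi\lambda_i r$ for $i=1,3$, and $$\tau_2(r)=\bar m\int_0^\infty 2\pi\lambda_{p_2}\frac z\sigma\, q\Big(\frac z\sigma,\frac r\sigma\Big)\exp\Big(-\bar m\Big(1-Q_1\Big(\frac z\sigma,\frac r\sigma\Big)\Big)\Big)dz .$$ Then for each $i\in\{1,2,3\}$ (for $i=1$ provided that $\lambda_1>0$) we have $\mathcal{G}_{3,i}>0$, and, conditional on $\mathcal{S}_i$, the distance $R_i$ from the typical user to its serving node has the probability density (on $x>0$) $$f_{\mathcal{S}_i}(x)=\frac{\tau_i(x)}{\mathcal{G}_{3,i}}\exp\Big(-\int_0^\infty 2\pi\lambda_{p_2}z\Big(1-\exp\Big(-\bar m\Big(1-Q_1\Big(\frac z\sigma,\frac{(P_2/P_i)^{1/\beta}x}{\sigma}\Big)\Big)\Big)\Big)dz\Big)\exp\Big(-\pi\sum_{j\in\{1,3\}}\lambda_j\Big(\frac{P_j}{P_i}\Big)^{2/\beta}x^2\Big).$$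 -/

import Mathlib

open MeasureTheory ProbabilityTheory
open scoped ENNReal

noncomputable section

namespace HetNet

/-- The Euclidean plane; the typical user sits at the origin `0`. -/
abbrev Plane := EuclideanSpace ℝ (Fin 2)

/-- The three tiers: cache-enabled users (`one`), small base stations (`two`),
macro base stations (`three`). -/
inductive Tier
  | one
  | two
  | three

section PointProcesses

/-- Locally finite counting measures: every bounded Borel set has a (finite) integer mass. -/
def IsCountingMeasure (μ : Measure Plane) : Prop :=
  ∀ B : Set Plane, MeasurableSet B → Bornology.IsBounded B → ∃ n : ℕ, μ B = n

/-- A point process in the plane: a random locally finite counting measure. Here `Φ ω B` is the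
number of points in `B`; `Measure Plane` carries the σ-algebra generated by `μ ↦ μ B`, `B` Borel. -/
structure IsPointProcess {Ω : Type*} [MeasurableSpace Ω] (Φ : Ω → Measure Plane) : Prop where
  measurable : Measurable Φ
  counting : ∀ ω, IsCountingMeasure (Φ ω)

/-- Poisson point process with intensity measure `Λ`: the counts are Poisson distributed, and
counts in pairwise disjoint Borel sets are independent. -/
structure IsPoissonProcess {Ω : Type*} [MeasurableSpace Ω] (Pr : Measure Ω)
    (Φ : Ω → Measure Plane) (Λ : Measure Plane) : Prop extends IsPointProcess Φ where
  law_count : ∀ B : Set Plane, MeasurableSet B → Λ B ≠ ∞ →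
    Pr.map (fun ω => Φ ω B) = (poissonMeasure (Λ B).toNNReal).map (fun n : ℕ => (n : ℝ≥0∞))
  indep_count : ∀ (n : ℕ) (B : Fin n → Set Plane), (∀ k, MeasurableSet (B k)) →
    Pairwise (fun k l => Disjoint (B k) (B l)) → iIndepFun (fun k ω => Φ ω (B k)) Pr

/-- Homogeneous Poisson point process of intensity `lam`. -/
def IsHomogeneousPoisson {Ω : Type*} [MeasurableSpace Ω] (Pr : Measure Ω)
    (Φ : Ω → Measure Plane) (lam : ℝ) : Prop :=
  IsPoissonProcess Pr Φ (ENNReal.ofReal lam • (volume : Measure Plane))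

/-- The isotropic Gaussian displacement density `exp (-‖y‖² / (2 σ²)) / (2 π σ²)`. -/
def displacementDensity (σ : ℝ) (y : Plane) : ℝ :=
  Real.exp (-‖y‖ ^ 2 / (2 * σ ^ 2)) / (2 * Real.pi * σ ^ 2)

/-- Thomas cluster process: the parents `X 0, X 1, …` form a homogeneous Poisson process of
intensity `lamp`; the clusters `Ψ i` are i.i.d., independent of the parents, Poisson processes with
intensity function `mbar * displacementDensity σ`; and `Φ` is the superposition of the shifted
clusters `X i + Ψ i`. -/
structure IsThomasProcess {Ω : Type*} [MeasurableSpace Ω] (Pr : Measure Ω)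
    (Φ : Ω → Measure Plane) (lamp mbar σ : ℝ) : Prop extends IsPointProcess Φ where
  exists_clusters : ∃ (X : ℕ → Ω → Plane) (Ψ : ℕ → Ω → Measure Plane),
    (∀ i, Measurable (X i)) ∧
    IsHomogeneousPoisson Pr (fun ω => Measure.sum fun i => Measure.dirac (X i ω)) lamp ∧
    (∀ i, IsPoissonProcess Pr (Ψ i)
      (volume.withDensity fun y => ENNReal.ofReal (mbar * displacementDensity σ y))) ∧
    iIndepFun Ψ Pr ∧
    IndepFun (fun ω i => X i ω) (fun ω i => Ψ i ω) Pr ∧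
    ∀ᵐ ω ∂Pr, Φ ω = Measure.sum fun i => (Ψ i ω).map (fun y => X i ω + y)

/-- The points of a counting measure are its atoms. -/
def points (μ : Measure Plane) : Set Plane := {x | μ {x} ≠ 0}

/-- Distance from the origin to the closest point (`∞` if there is no point). -/
def contactDist (μ : Measure Plane) : ℝ≥0∞ := ⨅ x ∈ points μ, ‖x‖ₑ

end PointProcesses

section Network

/-- Maximal received power `P i * ‖xᵢ*‖ ^ (-β)` from tier `i`
(`0` if the tier has no point, `∞` if it has a point at the origin). -/
def maxPower {Ω : Type*} (P : Tier → ℝ) (β : ℝ) (Φ : Tier → Ω → Measure Plane)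
    (i : Tier) (ω : Ω) : ℝ≥0∞ :=
  ENNReal.ofReal (P i) * contactDist (Φ i ω) ^ (-β)

/-- The event that the typical user associates with tier `i`. -/
def assocEvent {Ω : Type*} (P : Tier → ℝ) (β : ℝ) (Φ : Tier → Ω → Measure Plane)
    (i : Tier) : Set Ω :=
  {ω | ∀ n, n ≠ i → maxPower P β Φ n ω < maxPower P β Φ i ω}

/-- The three-tier network: tiers one and three are homogeneous Poisson processes, tier two is a
Thomas cluster process, and the three tiers are independent. -/
structure IsNetwork {Ω : Type*} [MeasurableSpace Ω] (Pr : Measure Ω)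
    (Φ : Tier → Ω → Measure Plane) (lam₁ lam₃ lamp mbar σ : ℝ) : Prop where
  tier_one : IsHomogeneousPoisson Pr (Φ Tier.one) lam₁
  tier_two : IsThomasProcess Pr (Φ Tier.two) lamp mbar σ
  tier_three : IsHomogeneousPoisson Pr (Φ Tier.three) lam₃
  indep : iIndepFun Φ Pr

end Network

section Formulas

/-- Modified Bessel function of the first kind of order zero. -/
def besselI0 (z : ℝ) : ℝ := Real.pi⁻¹ * ∫ φ in (0 : ℝ)..Real.pi, Real.exp (z * Real.cos φ)

/-- First-order Marcum Q-function. -/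
def marcumQ1 (a b : ℝ) : ℝ :=
  ∫ z in Set.Ioi b, z * Real.exp (-(z ^ 2 + a ^ 2) / 2) * besselI0 (a * z)

/-- Density at `b` of the Rice distribution with parameters `a` and `1`. -/
def ricePdf (a b : ℝ) : ℝ := b * Real.exp (-(b ^ 2 + a ^ 2) / 2) * besselI0 (a * b)

/-- The void factor of the Thomas cluster process at radius `r`. -/
def tcpVoid (lamp mbar σ r : ℝ) : ℝ :=
  Real.exp (-∫ z in Set.Ioi (0 : ℝ),
    2 * Real.pi * lamp * z * (1 - Real.exp (-mbar * (1 - marcumQ1 (z / σ) (r / σ)))))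

/-- The functions `τ₁, τ₂, τ₃`. -/
def tau (lam₁ lam₃ lamp mbar σ : ℝ) : Tier → ℝ → ℝ
  | Tier.one, r => 2 * Real.pi * lam₁ * r
  | Tier.two, r => mbar * ∫ z in Set.Ioi (0 : ℝ),
      2 * Real.pi * lamp * (z / σ) * ricePdf (z / σ) (r / σ) *
        Real.exp (-mbar * (1 - marcumQ1 (z / σ) (r / σ)))
  | Tier.three, r => 2 * Real.pi * lam₃ * r

/-- The claimed density of the distance to the serving node given association with tier `i`, where
`G` stands for the probability of that association. -/
def servingDensity (P : Tier → ℝ) (β lam₁ lam₃ lamp mbar σ G : ℝ) (i : Tier) (x : ℝ) : ℝ :=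
  tau lam₁ lam₃ lamp mbar σ i x / G *
    tcpVoid lamp mbar σ ((P Tier.two / P i) ^ (1 / β) * x) *
    Real.exp (-Real.pi * (lam₁ * (P Tier.one / P i) ^ (2 / β) +
      lam₃ * (P Tier.three / P i) ^ (2 / β)) * x ^ 2)

end Formulas

end HetNet

end

/-!
Call `h` the hazard rate of a random distance `R` with values in `[0, ∞]` if
`P(R ≥ r) = exp (-∫₀ʳ h)` for all `r ≥ 0` (`HasHazardRate`). The distances `R₁, R₂, R₃` from the
origin to the closest node of each tier are independent, and `τ₁, τ₂, τ₃` are their hazard rates.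
Granted this, `Rᵢ` has density `τᵢ(x) exp (-∫₀ˣ τᵢ)` on `(0, ∞)`. Comparing powers is comparing
distances: tier `i` serves the user exactly when `Rₙ > (Pₙ / Pᵢ) ^ (1 / β) * Rᵢ` for the two other
tiers (`power_lt_power_iff`). Conditioning on `Rᵢ = x`, this has as probability the product of the
survival functions of the other two distances at `(Pₙ / Pᵢ) ^ (1 / β) * x` (`measure_competing`).
This gives the joint law of `Rᵢ` and the association event; its total mass is positive since
`τᵢ > 0`, and dividing by it gives the claimed density (`cond_assocEvent_map`,
`servingDensity_eq`).

The event `R ≥ r` says that the open disc of radius `r` is void (`le_contactDist_iff`). For a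
Poisson process its probability is immediate. For the Thomas process, given the parents the clusters
miss the disc independently, a cluster centred at `x` with probability `exp (-m F(‖x‖, r))`, where
`F(z, r)` is the mass that a Gaussian centred at distance `z` gives to the disc. The Laplace
functional of the parent process (`IsPoissonProcess.laplace`) turns the expected product into
`exp (-λ ∫ (1 - exp (-m F(‖x‖, r))) dx)` (`measure_cluster_process_void`). In polar coordinates the
radial part of a Gaussian is the Rice distribution, so `F(z, r) = 1 - Q₁(z / σ, r / σ)`
(`setLIntegral_displacementDensity`, `one_sub_marcumQ1_scaled`). Writing
`1 - exp (-m F(z, r))` as the integral over `[0, r]` of its derivative in `r` and exchanging the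
integrals identifies the exponent with `∫₀ʳ τ₂` (`lintegral_void_exponent`).
-/

noncomputable section

namespace HetNet

open Filter Topology Set

/-! ### The contact distance of a counting measure -/

/-- A mass less than one of a bounded set vanishes, so every non-atom has a null neighbourhood. -/
lemma IsCountingMeasure.exists_ball_null {μ : Measure Plane} (hμ : IsCountingMeasure μ) {x : Plane}
    (hx : μ {x} = 0) : ∃ ε > 0, μ (Metric.ball x ε) = 0 := by
  have hanti : Antitone fun n : ℕ => Metric.ball x (1 / ((n : ℝ) + 1)) := fun m n hmn =>
    Metric.ball_subset_ball (Nat.one_div_le_one_div hmn)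
  have hinter : ⋂ n : ℕ, Metric.ball x (1 / ((n : ℝ) + 1)) = {x} := by
    ext y
    simp only [mem_iInter, Metric.mem_ball, mem_singleton_iff]
    refine ⟨fun h => ?_, fun h n => by rw [h, dist_self]; positivity⟩
    by_contra hne
    obtain ⟨n, hn⟩ := exists_nat_one_div_lt (dist_pos.2 hne)
    exact absurd (h n) (not_lt.2 hn.le)
  have hfin : μ (Metric.ball x (1 / (((0 : ℕ) : ℝ) + 1))) ≠ ∞ := by
    obtain ⟨k, hk⟩ := hμ _ measurableSet_ball (Metric.isBounded_ball (x := x)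
      (r := 1 / (((0 : ℕ) : ℝ) + 1)))
    rw [hk]
    exact ENNReal.natCast_ne_top k
  have hlim := tendsto_measure_iInter_atTop (μ := μ)
    (fun n => measurableSet_ball.nullMeasurableSet) hanti ⟨0, hfin⟩
  rw [hinter, hx] at hlim
  obtain ⟨n, hn⟩ := (hlim.eventually_lt_const one_pos).exists
  refine ⟨1 / ((n : ℝ) + 1), by positivity, ?_⟩
  obtain ⟨k, hk⟩ := hμ _ measurableSet_ball (Metric.isBounded_ball (x := x)
    (r := 1 / ((n : ℝ) + 1)))
  simp only [Function.comp_apply, hk] at hn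
  rw [hk]
  have : k < 1 := by exact_mod_cast hn
  simp [Nat.lt_one_iff.1 this]

/-- The closest point is at distance at least `r` exactly when the open ball of radius `r` is
void. -/
lemma IsCountingMeasure.le_contactDist_iff {μ : Measure Plane} (hμ : IsCountingMeasure μ)
    (r : ℝ) : ENNReal.ofReal r ≤ contactDist μ ↔ μ (Metric.ball 0 r) = 0 := by
  rw [contactDist, le_iInf₂_iff]
  constructor
  · intro h
    refine measure_null_of_locally_null _ fun x hx => ?_
    have hx0 : μ {x} = 0 := by
      by_contra hne
      refine absurd (h x hne) (not_le.2 ?_)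
      rw [← ofReal_norm]
      have hx' : ‖x‖ < r := by simpa using hx
      exact (ENNReal.ofReal_lt_ofReal_iff ((norm_nonneg x).trans_lt hx')).2 hx'
    obtain ⟨ε, hε, h0⟩ := hμ.exists_ball_null hx0
    exact ⟨_, mem_nhdsWithin_of_mem_nhds (Metric.ball_mem_nhds x hε), h0⟩
  · intro h x hx
    by_contra! hlt
    refine hx (measure_mono_null (singleton_subset_iff.2 ?_) h)
    rw [← ofReal_norm] at hlt
    simpa using (ENNReal.ofReal_lt_ofReal_iff_of_nonneg (norm_nonneg x)).1 hlt

/-- The largest radius of a void disc around the origin, as a supremum over rational radii. On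
counting measures this is `contactDist`, expressed through countably many counts and hence
measurable in the measure. -/
def voidRadius (μ : Measure Plane) : ℝ≥0∞ :=
  ⨆ q : ℚ, {ν : Measure Plane | ν (Metric.ball 0 q) = 0}.indicator
    (fun _ => ENNReal.ofReal q) μ

lemma measurable_voidRadius : Measurable voidRadius :=
  Measurable.iSup fun q => measurable_const.indicator
    ((Measure.measurable_coe (s := Metric.ball 0 (q : ℝ)) measurableSet_ball)
      (measurableSet_singleton 0))

lemma IsCountingMeasure.voidRadius_eq {μ : Measure Plane} (hμ : IsCountingMeasure μ) :
    voidRadius μ = contactDist μ := by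
  refine le_antisymm (iSup_le fun q => ?_) (le_of_forall_lt fun a ha => ?_)
  · by_cases hq : μ (Metric.ball 0 q) = 0
    · rw [indicator_of_mem (show μ ∈ {ν : Measure Plane | ν (Metric.ball 0 q) = 0} from hq)]
      exact (hμ.le_contactDist_iff q).2 hq
    · rw [indicator_of_notMem (show μ ∉ {ν : Measure Plane | ν (Metric.ball 0 q) = 0} from hq)]
      exact zero_le
  · obtain ⟨q, -, haq, hq⟩ := ENNReal.lt_iff_exists_rat_btwn.1 ha
    refine haq.trans_le (le_iSup_of_le q (le_of_eq ?_))
    rw [indicator_of_mem]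
    · rfl
    · exact (hμ.le_contactDist_iff q).1 hq.le

lemma IsPointProcess.contactDist_eq {Ω : Type*} [MeasurableSpace Ω]
    {Φ : Ω → Measure Plane} (hΦ : IsPointProcess Φ) :
    (fun ω => contactDist (Φ ω)) = voidRadius ∘ Φ :=
  funext fun ω => ((hΦ.counting ω).voidRadius_eq).symm

lemma IsPointProcess.measurable_contactDist {Ω : Type*} [MeasurableSpace Ω]
    {Φ : Ω → Measure Plane} (hΦ : IsPointProcess Φ) :
    Measurable fun ω => contactDist (Φ ω) := by
  rw [hΦ.contactDist_eq]
  exact measurable_voidRadius.comp hΦ.measurable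

lemma IsNetwork.isPointProcess {Ω : Type*} [MeasurableSpace Ω] {Pr : Measure Ω}
    {Φ : Tier → Ω → Measure Plane} {lam₁ lam₃ lamp mbar σ : ℝ}
    (hΦ : IsNetwork Pr Φ lam₁ lam₃ lamp mbar σ) : ∀ n, IsPointProcess (Φ n)
  | Tier.one => hΦ.tier_one.toIsPointProcess
  | Tier.two => hΦ.tier_two.toIsPointProcess
  | Tier.three => hΦ.tier_three.toIsPointProcess

lemma IsNetwork.iIndepFun_contactDist {Ω : Type*} [MeasurableSpace Ω] {Pr : Measure Ω}
    {Φ : Tier → Ω → Measure Plane} {lam₁ lam₃ lamp mbar σ : ℝ}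
    (hΦ : IsNetwork Pr Φ lam₁ lam₃ lamp mbar σ) :
    iIndepFun (fun n ω => contactDist (Φ n ω)) Pr := by
  have : (fun n ω => contactDist (Φ n ω)) = fun n => voidRadius ∘ Φ n :=
    funext fun n => (hΦ.isPointProcess n).contactDist_eq
  rw [this]
  exact hΦ.indep.comp (fun _ => voidRadius) fun _ => measurable_voidRadius

section

/-! ### The Laplace functional of a Poisson process -/

/-- The function `t ↦ exp (-t)` on `[0, ∞]`, with `exp (-∞) = 0`. -/
def expNeg (t : ℝ≥0∞) : ℝ≥0∞ := EReal.exp (-(t : EReal))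

@[simp] lemma expNeg_zero : expNeg 0 = 1 := by simp [expNeg]

lemma expNeg_ofReal {x : ℝ} (hx : 0 ≤ x) :
    expNeg (ENNReal.ofReal x) = ENNReal.ofReal (Real.exp (-x)) := by
  rw [expNeg, EReal.coe_ennreal_ofReal, max_eq_left hx, ← EReal.coe_neg, EReal.exp_coe]

lemma expNeg_add (s t : ℝ≥0∞) : expNeg (s + t) = expNeg s * expNeg t := by
  rw [expNeg, EReal.coe_ennreal_add, EReal.neg_add, sub_eq_add_neg, EReal.exp_add]
  · rfl
  all_goals simp

lemma antitone_expNeg : Antitone expNeg := fun _ _ h =>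
  EReal.exp_monotone (EReal.neg_le_neg_iff.2 (EReal.coe_ennreal_le_coe_ennreal_iff.2 h))

lemma expNeg_le_one (t : ℝ≥0∞) : expNeg t ≤ 1 := by
  simpa using antitone_expNeg (zero_le (a := t))

lemma continuous_expNeg : Continuous expNeg :=
  EReal.expOrderIso.continuous.comp (continuous_neg.comp continuous_coe_ennreal_ereal)

@[fun_prop] lemma measurable_expNeg : Measurable expNeg := continuous_expNeg.measurable

lemma expNeg_sum {ι : Type*} (s : Finset ι) (f : ι → ℝ≥0∞) :
    expNeg (∑ k ∈ s, f k) = ∏ k ∈ s, expNeg (f k) := by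
  classical
  induction s using Finset.induction_on with
  | empty => simp
  | insert a s ha ih => rw [Finset.sum_insert ha, Finset.prod_insert ha, expNeg_add, ih]

lemma lintegral_expNeg_poissonMeasure (r : NNReal) {c : ℝ} (hc : 0 ≤ c) :
    ∫⁻ n : ℕ, expNeg (ENNReal.ofReal c * n) ∂poissonMeasure r =
      expNeg (r * (1 - expNeg (ENNReal.ofReal c))) := by
  have hterm : ∀ n : ℕ, expNeg (ENNReal.ofReal c * n) * poissonMeasure r {n} =
      ENNReal.ofReal (Real.exp (-r) * ((r * Real.exp (-c)) ^ n / n.factorial)) := fun n => by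
    rw [poissonMeasure_singleton, ← ENNReal.ofReal_natCast, ← ENNReal.ofReal_mul hc,
      expNeg_ofReal (by positivity), ← ENNReal.ofReal_mul (by positivity), mul_pow,
      ← Real.exp_nat_mul]
    congr 1
    rw [show (n : ℝ) * -c = -(c * n) by ring]
    ring
  have hsum : HasSum (fun n : ℕ => Real.exp (-r) * ((r * Real.exp (-c)) ^ n / n.factorial))
      (Real.exp (-r) * Real.exp (r * Real.exp (-c))) := by
    have := NormedSpace.expSeries_div_hasSum_exp (r * Real.exp (-c))
    rw [← Real.exp_eq_exp_ℝ] at this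
    exact this.mul_left _
  have hexp : 0 ≤ 1 - Real.exp (-c) := by simpa using hc
  rw [lintegral_countable']
  simp_rw [hterm]
  rw [← ENNReal.ofReal_tsum_of_nonneg (fun n => by positivity) hsum.summable, hsum.tsum_eq,
    expNeg_ofReal hc, ← ENNReal.ofReal_one, ← ENNReal.ofReal_sub _ (Real.exp_pos _).le,
    ← ENNReal.ofReal_coe_nnreal, ← ENNReal.ofReal_mul (by positivity),
    expNeg_ofReal (by positivity), ← Real.exp_add]
  congr 2
  ring

variable {Ω : Type*} [MeasurableSpace Ω] {Pr : Measure Ω} {Φ : Ω → Measure Plane}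
  {Λ : Measure Plane}

lemma IsPoissonProcess.measurable_apply (h : IsPoissonProcess Pr Φ Λ) {B : Set Plane}
    (hB : MeasurableSet B) : Measurable fun ω => Φ ω B :=
  (Measure.measurable_coe hB).comp h.measurable

lemma IsPoissonProcess.lintegral_expNeg_count (h : IsPoissonProcess Pr Φ Λ) {B : Set Plane}
    (hB : MeasurableSet B) (hΛ : Λ B ≠ ∞) {c : ℝ≥0∞} (hc : c ≠ ∞) :
    ∫⁻ ω, expNeg (c * Φ ω B) ∂Pr = expNeg ((1 - expNeg c) * Λ B) := by
  have hm : Measurable fun t : ℝ≥0∞ => expNeg (c * t) := by fun_prop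
  rw [← lintegral_map (f := fun t => expNeg (c * t)) hm (h.measurable_apply hB),
    h.law_count B hB hΛ, lintegral_map hm (measurable_of_countable _),
    ← ENNReal.ofReal_toReal hc, lintegral_expNeg_poissonMeasure _ ENNReal.toReal_nonneg,
    ENNReal.coe_toNNReal hΛ, mul_comm]

lemma IsPoissonProcess.measure_void (h : IsPoissonProcess Pr Φ Λ) {B : Set Plane}
    (hB : MeasurableSet B) (hΛ : Λ B ≠ ∞) : Pr {ω | Φ ω B = 0} = expNeg (Λ B) := by
  have h0 : (fun n : ℕ => (n : ℝ≥0∞)) ⁻¹' {0} = {0} := by ext; simp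
  have : {ω | Φ ω B = 0} = (fun ω => Φ ω B) ⁻¹' {0} := rfl
  rw [this, ← Measure.map_apply (h.measurable_apply hB) (measurableSet_singleton 0),
    h.law_count B hB hΛ,
    Measure.map_apply (measurable_of_countable _) (measurableSet_singleton 0), h0,
    poissonMeasure_singleton]
  simp [← expNeg_ofReal, ENNReal.ofReal_coe_nnreal, ENNReal.coe_toNNReal hΛ]

/-- For a simple function the Laplace functional factorizes over the level sets, whose counts are
independent. -/
lemma IsPoissonProcess.laplace_simpleFunc (h : IsPoissonProcess Pr Φ Λ)
    (g : SimpleFunc Plane ℝ≥0∞) (htop : ∀ x, g x ≠ ∞)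
    (hfin : ∀ c, c ≠ 0 → Λ (g ⁻¹' {c}) ≠ ∞) :
    ∫⁻ ω, expNeg (∫⁻ x, g x ∂Φ ω) ∂Pr = expNeg (∫⁻ x, (1 - expNeg (g x)) ∂Λ) := by
  classical
  -- the value `0` is left out: its level set may have infinite intensity
  set s : Finset ℝ≥0∞ := g.range.filter (· ≠ 0) with hs
  have e := s.equivFin
  set B : Fin s.card → Set Plane := fun k => g ⁻¹' {(e.symm k : ℝ≥0∞)} with hBdef
  have hB : ∀ k, MeasurableSet (B k) := fun k => g.measurableSet_fiber _
  have hdisj : Pairwise fun k l => Disjoint (B k) (B l) := fun k l hkl => by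
    refine Disjoint.preimage _ (disjoint_singleton.2 fun heq => hkl ?_)
    exact e.symm.injective (Subtype.ext heq)
  have hsum : ∀ (F : ℝ≥0∞ → ℝ≥0∞), F 0 = 0 → ∀ μ : Measure Plane,
      ∫⁻ x, F (g x) ∂μ = ∑ k, F (e.symm k) * μ (B k) := fun F hF μ => by
    have h1 : ∫⁻ x, F (g x) ∂μ = (g.map F).lintegral μ := by
      rw [← SimpleFunc.lintegral_eq_lintegral]
      rfl
    rw [h1, SimpleFunc.map_lintegral,
      e.symm.sum_comp (fun c : s => F c * μ (g ⁻¹' {(c : ℝ≥0∞)})),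
      Finset.sum_coe_sort s (fun c => F c * μ (g ⁻¹' {c})), hs, Finset.sum_filter]
    refine Finset.sum_congr rfl fun c _ => ?_
    by_cases hc : c = 0 <;> simp [hc, hF]
  have hmem : ∀ k, (e.symm k : ℝ≥0∞) ∈ g.range ∧ (e.symm k : ℝ≥0∞) ≠ 0 := fun k =>
    Finset.mem_filter.1 (e.symm k).2
  have hct : ∀ k, (e.symm k : ℝ≥0∞) ≠ ∞ := fun k => by
    obtain ⟨x, hx⟩ := SimpleFunc.mem_range.1 (hmem k).1
    exact hx ▸ htop x
  have hind : iIndepFun (fun k ω => expNeg (e.symm k * Φ ω (B k))) Pr :=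
    (h.indep_count _ B hB hdisj).comp (fun k t => expNeg (e.symm k * t)) fun k => by fun_prop
  have hsum_id : ∀ μ : Measure Plane, ∫⁻ x, g x ∂μ = ∑ k, (e.symm k : ℝ≥0∞) * μ (B k) :=
    hsum id rfl
  simp_rw [hsum_id, expNeg_sum]
  rw [lintegral_prod_eq_prod_lintegral_of_indepFun Finset.univ
      (fun k ω => expNeg (e.symm k * Φ ω (B k))) hind
      fun k => measurable_expNeg.comp ((h.measurable_apply (hB k)).const_mul _),
    hsum (fun t => 1 - expNeg t) (by simp), expNeg_sum]
  exact Finset.prod_congr rfl fun k _ =>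
    h.lintegral_expNeg_count (hB k) (hfin _ (hmem k).2) (hct k)

/-- **Laplace functional of a Poisson process**: `E exp (-∫ g dΦ) = exp (-∫ (1 - exp (-g)) dΛ)`. -/
theorem IsPoissonProcess.laplace [IsProbabilityMeasure Pr] [SigmaFinite Λ]
    (h : IsPoissonProcess Pr Φ Λ) {g : Plane → ℝ≥0∞} (hg : Measurable g) :
    ∫⁻ ω, expNeg (∫⁻ x, g x ∂Φ ω) ∂Pr = expNeg (∫⁻ x, (1 - expNeg (g x)) ∂Λ) := by
  set S := spanningSets Λ
  have hS : ∀ n, MeasurableSet (S n) := measurableSet_spanningSets Λ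
  set G : ℕ → SimpleFunc Plane ℝ≥0∞ := fun n => (SimpleFunc.eapprox g n).restrict (S n) with hG
  have hGapply : ∀ n x, G n x = (S n).indicator (SimpleFunc.eapprox g n) x := fun n x => by
    rw [hG, SimpleFunc.restrict_apply _ (hS n)]
  have hGmono : Monotone fun n => (G n : Plane → ℝ≥0∞) := fun m n hmn x => by
    simp only [hGapply]
    exact (indicator_le_indicator_of_subset (monotone_spanningSets Λ hmn) (fun _ => zero_le) x).trans
      (indicator_le_indicator (SimpleFunc.monotone_eapprox g hmn x))
  have hGlim : ∀ x, Tendsto (fun n => G n x) atTop (𝓝 (g x)) := fun x => by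
    refine (SimpleFunc.tendsto_eapprox hg x).congr' ?_
    filter_upwards [eventually_ge_atTop (spanningSetsIndex Λ x)] with n hn
    rw [hGapply, indicator_of_mem]
    exact monotone_spanningSets Λ hn (mem_spanningSetsIndex Λ x)
  have hstep : ∀ n, ∫⁻ ω, expNeg (∫⁻ x, G n x ∂Φ ω) ∂Pr =
      expNeg (∫⁻ x, (1 - expNeg (G n x)) ∂Λ) := fun n => by
    refine h.laplace_simpleFunc (G n) (fun x => ?_) fun c hc => ?_
    · rw [hGapply]
      by_cases hx : x ∈ S n
      · rw [indicator_of_mem hx]; exact (SimpleFunc.eapprox_lt_top g n x).ne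
      · rw [indicator_of_notMem hx]; exact ENNReal.zero_ne_top
    · refine ((measure_mono fun x hx => ?_).trans_lt (measure_spanningSets_lt_top Λ n)).ne
      by_contra hxS
      have hxc : G n x = c := hx
      rw [hGapply, indicator_of_notMem hxS] at hxc
      exact hc hxc.symm
  have hleft : Tendsto (fun n => ∫⁻ ω, expNeg (∫⁻ x, G n x ∂Φ ω) ∂Pr) atTop
      (𝓝 (∫⁻ ω, expNeg (∫⁻ x, g x ∂Φ ω) ∂Pr)) := by
    refine tendsto_lintegral_of_dominated_convergence (fun _ => 1) (fun n => ?_)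
      (fun n => ae_of_all _ fun ω => expNeg_le_one _) (by simp) (ae_of_all _ fun ω => ?_)
    · exact measurable_expNeg.comp ((Measure.measurable_lintegral (G n).measurable).comp h.measurable)
    · exact (continuous_expNeg.tendsto _).comp (lintegral_tendsto_of_tendsto_of_monotone
        (fun n => (G n).measurable.aemeasurable) (ae_of_all _ fun x m n hmn => hGmono hmn x)
        (ae_of_all _ hGlim))
  have hright : Tendsto (fun n => expNeg (∫⁻ x, (1 - expNeg (G n x)) ∂Λ)) atTop
      (𝓝 (expNeg (∫⁻ x, (1 - expNeg (g x)) ∂Λ))) := by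
    refine (continuous_expNeg.tendsto _).comp (lintegral_tendsto_of_tendsto_of_monotone
        (fun n => ?_) (ae_of_all _ fun x m n hmn => ?_) (ae_of_all _ fun x => ?_))
    · exact (measurable_const.sub (measurable_expNeg.comp (G n).measurable)).aemeasurable
    · exact tsub_le_tsub_left (antitone_expNeg (hGmono hmn x)) 1
    · exact ENNReal.Tendsto.sub tendsto_const_nhds ((continuous_expNeg.tendsto _).comp (hGlim x))
        (Or.inl ENNReal.one_ne_top)
  simp_rw [hstep] at hleft
  exact tendsto_nhds_unique hleft hright

end

/-! ### Polar coordinates and the Bessel function -/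

/-- The point of the plane with polar coordinates `(s, φ)`. -/
def ofPolar (s φ : ℝ) : Plane := !₂[s * Real.cos φ, s * Real.sin φ]

lemma norm_ofPolar_sub_sq (s φ ρ θ : ℝ) :
    ‖ofPolar s φ - ofPolar ρ θ‖ ^ 2 = s ^ 2 + ρ ^ 2 - 2 * s * ρ * Real.cos (φ - θ) := by
  rw [EuclideanSpace.norm_sq_eq, Real.cos_sub]
  simp only [ofPolar, Fin.sum_univ_two, PiLp.sub_apply, Real.norm_eq_abs, sq_abs]
  simp only [Matrix.cons_val_zero, Matrix.cons_val_one]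
  linear_combination s ^ 2 * Real.sin_sq_add_cos_sq φ + ρ ^ 2 * Real.sin_sq_add_cos_sq θ

lemma norm_ofPolar {s : ℝ} (hs : 0 ≤ s) (φ : ℝ) : ‖ofPolar s φ‖ = s := by
  have h0 : ofPolar 0 0 = 0 := by ext i; fin_cases i <;> simp [ofPolar]
  have := norm_ofPolar_sub_sq s φ 0 0
  rw [h0, sub_zero] at this
  exact (pow_left_inj₀ (norm_nonneg _) hs two_ne_zero).1 (by rw [this]; ring)

lemma exists_eq_ofPolar (x : Plane) : ∃ θ, x = ofPolar ‖x‖ θ := by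
  set z : ℂ := ⟨x 0, x 1⟩ with hz
  have hnorm : ‖z‖ = ‖x‖ := by
    refine (pow_left_inj₀ (norm_nonneg _) (norm_nonneg _) two_ne_zero).1 ?_
    rw [EuclideanSpace.norm_sq_eq, Complex.sq_norm, Complex.normSq_apply, Fin.sum_univ_two]
    simp only [Real.norm_eq_abs, sq_abs, hz]
    ring
  refine ⟨z.arg, ?_⟩
  ext i
  rw [ofPolar, ← hnorm, Complex.norm_mul_cos_arg, Complex.norm_mul_sin_arg]
  fin_cases i <;> simp [hz]

lemma continuous_ofPolar : Continuous fun p : ℝ × ℝ => ofPolar p.1 p.2 := by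
  refine (PiLp.continuous_toLp 2 _).comp (continuous_pi fun i => ?_)
  fin_cases i
  · exact continuous_fst.mul (Real.continuous_cos.comp continuous_snd)
  · exact continuous_fst.mul (Real.continuous_sin.comp continuous_snd)

lemma lintegral_plane_polar {F : Plane → ℝ≥0∞} (hF : Measurable F) :
    ∫⁻ u, F u = ∫⁻ s in Ioi (0 : ℝ),
      ENNReal.ofReal s * ∫⁻ φ in Ioo (-Real.pi) Real.pi, F (ofPolar s φ) := by
  have h1 : MeasurePreserving (fun p : ℝ × ℝ => (!₂[p.1, p.2] : Plane)) volume volume :=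
    (EuclideanSpace.volume_preserving_symm_measurableEquiv_toLp (Fin 2)).symm.comp
      (volume_preserving_finTwoArrow ℝ).symm
  have hm : Measurable fun p : ℝ × ℝ => F (ofPolar p.1 p.2) :=
    hF.comp continuous_ofPolar.measurable
  rw [← h1.lintegral_comp hF, ← lintegral_comp_polarCoord_symm, polarCoord_target,
    Measure.volume_eq_prod, setLIntegral_prod]
  · refine lintegral_congr fun s => ?_
    simp only [polarCoord_symm_apply, smul_eq_mul]
    exact lintegral_const_mul _ (hm.comp measurable_prodMk_left)
  · simp only [polarCoord_symm_apply, smul_eq_mul]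
    exact ((measurable_fst.ennreal_ofReal).mul hm).aemeasurable

lemma lintegral_comp_norm_plane {h : ℝ → ℝ≥0∞} (hh : Measurable h) :
    ∫⁻ x : Plane, h ‖x‖ = ∫⁻ z in Ioi (0 : ℝ), ENNReal.ofReal (2 * Real.pi * z) * h z := by
  rw [lintegral_plane_polar (F := fun x => h ‖x‖) (hh.comp measurable_norm)]
  refine setLIntegral_congr_fun measurableSet_Ioi fun z hz => ?_
  have hz' : 0 ≤ z := (mem_Ioi.1 hz).le
  simp_rw [norm_ofPolar hz', setLIntegral_const, Real.volume_Ioo]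
  rw [ENNReal.ofReal_mul (by positivity), mul_comm (h z), ← mul_assoc,
    mul_comm (ENNReal.ofReal z), sub_neg_eq_add, two_mul]

lemma continuous_besselI0 : Continuous besselI0 := by
  unfold besselI0
  refine continuous_const.mul
    (intervalIntegral.continuous_parametric_intervalIntegral_of_continuous' ?_ _ _)
  simp only [Function.uncurry_def]
  fun_prop

lemma besselI0_pos (w : ℝ) : 0 < besselI0 w := by
  refine mul_pos (inv_pos.2 Real.pi_pos) ?_
  refine intervalIntegral.intervalIntegral_pos_of_pos
    (Continuous.intervalIntegrable (by fun_prop) _ _) (fun φ => Real.exp_pos _) Real.pi_pos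

lemma besselI0_le_exp {w : ℝ} (hw : 0 ≤ w) : besselI0 w ≤ Real.exp w := by
  have h : ∫ φ in (0 : ℝ)..Real.pi, Real.exp (w * Real.cos φ) ≤
      ∫ _ in (0 : ℝ)..Real.pi, Real.exp w :=
    intervalIntegral.integral_mono_on Real.pi_pos.le
      (Continuous.intervalIntegrable (by fun_prop) _ _)
      (Continuous.intervalIntegrable (by fun_prop) _ _) fun φ _ =>
        Real.exp_le_exp.2 (by nlinarith [Real.cos_le_one φ])
  rw [intervalIntegral.integral_const, sub_zero, smul_eq_mul] at h
  rw [besselI0, inv_mul_le_iff₀ Real.pi_pos]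
  exact h

/-- A full turn of the angle covers the half turn in the definition of `I₀` twice. -/
lemma integral_exp_cos_sub (w θ : ℝ) :
    ∫ φ in -Real.pi..Real.pi, Real.exp (w * Real.cos (φ - θ)) = 2 * Real.pi * besselI0 w := by
  have hper : Function.Periodic (fun φ => Real.exp (w * Real.cos φ)) (2 * Real.pi) := fun φ => by
    simp
  have hint : ∀ a b, IntervalIntegrable (fun φ => Real.exp (w * Real.cos φ)) volume a b :=
    fun a b => Continuous.intervalIntegrable (by fun_prop) _ _
  rw [intervalIntegral.integral_comp_sub_right (fun φ => Real.exp (w * Real.cos φ)),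
    show Real.pi - θ = (-Real.pi - θ) + 2 * Real.pi by ring,
    hper.intervalIntegral_add_eq _ (-Real.pi), show -Real.pi + 2 * Real.pi = Real.pi by ring,
    ← intervalIntegral.integral_add_adjacent_intervals (hint _ 0) (hint 0 _)]
  have hneg := intervalIntegral.integral_comp_neg (a := 0) (b := Real.pi)
    fun φ => Real.exp (w * Real.cos φ)
  simp only [Real.cos_neg, neg_zero] at hneg
  rw [← hneg, besselI0]
  field_simp
  ring

/-! ### The Rice distribution as the radial part of a Gaussian -/

lemma continuous_ricePdf : Continuous fun p : ℝ × ℝ => ricePdf p.1 p.2 := by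
  unfold ricePdf
  exact (by fun_prop : Continuous fun p : ℝ × ℝ =>
    p.2 * Real.exp (-(p.2 ^ 2 + p.1 ^ 2) / 2)).mul (continuous_besselI0.comp (by fun_prop))

lemma ricePdf_nonneg {a b : ℝ} (hb : 0 ≤ b) : 0 ≤ ricePdf a b :=
  mul_nonneg (mul_nonneg hb (Real.exp_pos _).le) (besselI0_pos _).le

lemma ricePdf_pos {a b : ℝ} (hb : 0 < b) : 0 < ricePdf a b :=
  mul_pos (mul_pos hb (Real.exp_pos _)) (besselI0_pos _)

lemma ricePdf_le {a b : ℝ} (ha : 0 ≤ a) (hb : 0 ≤ b) :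
    ricePdf a b ≤ b * Real.exp (-(a - b) ^ 2 / 2) := by
  rw [ricePdf, mul_assoc]
  refine mul_le_mul_of_nonneg_left ?_ hb
  calc Real.exp (-(b ^ 2 + a ^ 2) / 2) * besselI0 (a * b)
      ≤ Real.exp (-(b ^ 2 + a ^ 2) / 2) * Real.exp (a * b) :=
        mul_le_mul_of_nonneg_left (besselI0_le_exp (mul_nonneg ha hb)) (Real.exp_pos _).le
    _ = Real.exp (-(a - b) ^ 2 / 2) := by rw [← Real.exp_add]; congr 1; ring

/-- Density at `s` of the distance from the origin of a point whose cluster is centred at distance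
`z`: the Rice density, rescaled by `σ`. -/
def radialDensity (σ z s : ℝ) : ℝ := ricePdf (z / σ) (s / σ) / σ

/-- Probability that a point whose cluster is centred at distance `z` from the origin falls into
the disc of radius `r` around the origin. -/
def discMass (σ z r : ℝ) : ℝ := ∫ s in (0 : ℝ)..r, radialDensity σ z s

@[fun_prop] lemma continuous_radialDensity (σ : ℝ) :
    Continuous fun p : ℝ × ℝ => radialDensity σ p.1 p.2 :=
  (continuous_ricePdf.comp
    (by fun_prop : Continuous fun p : ℝ × ℝ => (p.1 / σ, p.2 / σ))).div_const σ

lemma continuous_radialDensity_right (σ z : ℝ) : Continuous (radialDensity σ z) :=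
  (continuous_radialDensity σ).comp (by fun_prop : Continuous fun s : ℝ => (z, s))

lemma continuous_discMass (σ : ℝ) : Continuous fun p : ℝ × ℝ => discMass σ p.1 p.2 :=
  intervalIntegral.continuous_parametric_intervalIntegral_of_continuous
    (f := fun (p : ℝ × ℝ) s => radialDensity σ p.1 s)
    ((continuous_radialDensity σ).comp
      (by fun_prop : Continuous fun q : (ℝ × ℝ) × ℝ => (q.1.1, q.2))) continuous_snd

lemma continuous_discMass_left (σ r : ℝ) : Continuous fun z => discMass σ z r :=
  Continuous.comp (g := fun p : ℝ × ℝ => discMass σ p.1 p.2) (f := fun z => (z, r))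
    (continuous_discMass σ) (by fun_prop)

lemma radialDensity_nonneg {σ z s : ℝ} (hσ : 0 < σ) (hs : 0 ≤ s) : 0 ≤ radialDensity σ z s :=
  div_nonneg (ricePdf_nonneg (div_nonneg hs hσ.le)) hσ.le

lemma discMass_nonneg {σ z r : ℝ} (hσ : 0 < σ) (hr : 0 ≤ r) : 0 ≤ discMass σ z r :=
  intervalIntegral.integral_nonneg hr fun _ hs => radialDensity_nonneg hσ hs.1

lemma continuous_displacementDensity (σ : ℝ) : Continuous (displacementDensity σ) := by
  unfold displacementDensity
  fun_prop

lemma displacementDensity_nonneg (σ : ℝ) (y : Plane) : 0 ≤ displacementDensity σ y := by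
  unfold displacementDensity
  positivity

lemma lintegral_displacementDensity_angle {σ : ℝ} (hσ : 0 < σ) (x : Plane) {s : ℝ} (hs : 0 < s) :
    ENNReal.ofReal s * ∫⁻ φ in Ioo (-Real.pi) Real.pi,
        ENNReal.ofReal (displacementDensity σ (ofPolar s φ - x)) =
      ENNReal.ofReal (radialDensity σ ‖x‖ s) := by
  obtain ⟨θ, hθ⟩ := exists_eq_ofPolar x
  set ρ := ‖x‖
  have hval : ∀ φ, displacementDensity σ (ofPolar s φ - x) =
      Real.exp (-(s ^ 2 + ρ ^ 2) / (2 * σ ^ 2)) / (2 * Real.pi * σ ^ 2) *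
        Real.exp (ρ / σ * (s / σ) * Real.cos (φ - θ)) := fun φ => by
    rw [displacementDensity, hθ, norm_ofPolar_sub_sq, div_mul_eq_mul_div, ← Real.exp_add]
    congr 2
    field_simp
    ring
  have hcont : Continuous fun φ => displacementDensity σ (ofPolar s φ - x) := by
    simp_rw [hval]
    fun_prop
  rw [setLIntegral_congr Ioo_ae_eq_Ioc, ← ofReal_integral_eq_lintegral_ofReal
      (hcont.integrableOn_Ioc) (ae_of_all _ fun φ => displacementDensity_nonneg _ _),
    ← ENNReal.ofReal_mul hs.le,
    ← intervalIntegral.integral_of_le (by linarith [Real.pi_pos])]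
  simp_rw [hval]
  rw [intervalIntegral.integral_const_mul, integral_exp_cos_sub, radialDensity, ricePdf]
  congr 1
  rw [show -((s / σ) ^ 2 + (ρ / σ) ^ 2) / 2 = -(s ^ 2 + ρ ^ 2) / (2 * σ ^ 2) by field_simp]
  field_simp

/-- The mass that the Gaussian displacement gives to a ball centred at `-x`. -/
lemma setLIntegral_displacementDensity {σ : ℝ} (hσ : 0 < σ) (x : Plane) (r : ℝ) :
    ∫⁻ y in Metric.ball (-x) r, ENNReal.ofReal (displacementDensity σ y) =
      ∫⁻ s in Ioc 0 r, ENNReal.ofReal (radialDensity σ ‖x‖ s) := by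
  have hm : Measurable fun u : Plane => ENNReal.ofReal (displacementDensity σ (u - x)) :=
    ((continuous_displacementDensity σ).comp (by fun_prop)).measurable.ennreal_ofReal
  have hshift : ∫⁻ y in Metric.ball (-x) r, ENNReal.ofReal (displacementDensity σ y) =
      ∫⁻ u, (Metric.ball 0 r).indicator
        (fun u => ENNReal.ofReal (displacementDensity σ (u - x))) u := by
    rw [← lintegral_indicator measurableSet_ball, ← lintegral_sub_right_eq_self _ x]
    refine lintegral_congr fun u => ?_
    simp only [indicator, Metric.mem_ball, dist_eq_norm, sub_neg_eq_add, sub_add_cancel, sub_zero]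
  have hout : ∀ s ∈ Ioi (0 : ℝ), ENNReal.ofReal s * ∫⁻ φ in Ioo (-Real.pi) Real.pi,
      (Metric.ball 0 r).indicator
        (fun u => ENNReal.ofReal (displacementDensity σ (u - x))) (ofPolar s φ) =
      (Iio r).indicator (fun s => ENNReal.ofReal (radialDensity σ ‖x‖ s)) s := by
    intro s hs
    by_cases hsr : s < r
    · rw [indicator_of_mem (mem_Iio.2 hsr), ← lintegral_displacementDensity_angle hσ x hs]
      congr 1
      refine lintegral_congr fun φ => indicator_of_mem ?_ _
      rwa [mem_ball_zero_iff, norm_ofPolar (mem_Ioi.1 hs).le]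
    · rw [indicator_of_notMem (by simpa using hsr)]
      have : ∀ φ, (Metric.ball (0 : Plane) r).indicator
          (fun u => ENNReal.ofReal (displacementDensity σ (u - x))) (ofPolar s φ) = 0 := fun φ =>
        indicator_of_notMem (by rwa [mem_ball_zero_iff, norm_ofPolar (mem_Ioi.1 hs).le]) _
      simp [this]
  rw [hshift, lintegral_plane_polar (hm.indicator measurableSet_ball),
    setLIntegral_congr_fun measurableSet_Ioi hout, setLIntegral_indicator measurableSet_Iio,
    inter_comm, Ioi_inter_Iio, setLIntegral_congr Ioo_ae_eq_Ioc]

lemma lintegral_displacementDensity {σ : ℝ} (hσ : 0 < σ) :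
    ∫⁻ y : Plane, ENNReal.ofReal (displacementDensity σ y) = 1 := by
  have h := GaussianFourier.integral_rexp_neg_mul_sq_norm (V := Plane) (b := 1 / (2 * σ ^ 2))
    (by positivity)
  have h1 : ∫ y : Plane, displacementDensity σ y = 1 := by
    unfold displacementDensity
    rw [integral_div]
    have : ∀ y : Plane, -‖y‖ ^ 2 / (2 * σ ^ 2) = -(1 / (2 * σ ^ 2)) * ‖y‖ ^ 2 := fun y => by ring
    simp_rw [this, h]
    simp
    field_simp
  rw [← ofReal_integral_eq_lintegral_ofReal (integrable_of_integral_eq_one h1)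
    (ae_of_all _ (displacementDensity_nonneg σ)), h1, ENNReal.ofReal_one]

lemma lintegral_ricePdf {a : ℝ} (ha : 0 ≤ a) :
    ∫⁻ s in Ioi (0 : ℝ), ENNReal.ofReal (ricePdf a s) = 1 := by
  have hm : Measurable fun u : Plane =>
      ENNReal.ofReal (displacementDensity 1 (u - ofPolar a 0)) :=
    ((continuous_displacementDensity 1).comp (by fun_prop)).measurable.ennreal_ofReal
  rw [← lintegral_displacementDensity one_pos, ← lintegral_sub_right_eq_self _ (ofPolar a 0),
    lintegral_plane_polar hm]
  refine setLIntegral_congr_fun measurableSet_Ioi fun s hs => ?_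
  rw [lintegral_displacementDensity_angle one_pos _ hs, norm_ofPolar ha]
  simp [radialDensity]

lemma integrableOn_ricePdf {a : ℝ} (ha : 0 ≤ a) : IntegrableOn (ricePdf a) (Ioi 0) := by
  refine ⟨(continuous_ricePdf.comp (by fun_prop : Continuous fun s : ℝ => (a, s))).aestronglyMeasurable,
    ?_⟩
  rw [hasFiniteIntegral_iff_ofReal, lintegral_ricePdf ha]
  · exact ENNReal.one_lt_top
  · filter_upwards [ae_restrict_mem measurableSet_Ioi] with s hs
    exact ricePdf_nonneg (mem_Ioi.1 hs).le

/-- The Marcum function is the tail of the Rice distribution, which has total mass one. -/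
lemma one_sub_marcumQ1 {a b : ℝ} (ha : 0 ≤ a) (hb : 0 ≤ b) :
    1 - marcumQ1 a b = ∫ s in (0 : ℝ)..b, ricePdf a s := by
  have hone : ∫ s in Ioi (0 : ℝ), ricePdf a s = 1 := by
    rw [integral_eq_lintegral_of_nonneg_ae, lintegral_ricePdf ha, ENNReal.toReal_one]
    · filter_upwards [ae_restrict_mem measurableSet_Ioi] with s hs
      exact ricePdf_nonneg (mem_Ioi.1 hs).le
    · exact (integrableOn_ricePdf ha).aestronglyMeasurable
  have hint := integrableOn_ricePdf ha
  have hsplit : ∫ s in Ioi (0 : ℝ), ricePdf a s =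
      (∫ s in Ioc 0 b, ricePdf a s) + ∫ s in Ioi b, ricePdf a s := by
    rw [← setIntegral_union (Ioc_disjoint_Ioi le_rfl) measurableSet_Ioi
      (hint.mono_set Ioc_subset_Ioi_self) (hint.mono_set (Ioi_subset_Ioi hb)), Ioc_union_Ioi_eq_Ioi hb]
  rw [intervalIntegral.integral_of_le hb, ← hone, hsplit]
  exact add_sub_cancel_right _ _

lemma one_sub_marcumQ1_scaled {σ z r : ℝ} (hσ : 0 < σ) (hz : 0 ≤ z) (hr : 0 ≤ r) :
    1 - marcumQ1 (z / σ) (r / σ) = discMass σ z r := by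
  unfold discMass radialDensity
  rw [one_sub_marcumQ1 (by positivity) (by positivity), intervalIntegral.integral_div,
    intervalIntegral.integral_comp_div (ricePdf (z / σ)) hσ.ne', zero_div, smul_eq_mul,
    mul_div_cancel_left₀ _ hσ.ne']

section

/-! ### The void probability of a Thomas process -/

/-- Being null on a ball is a countable condition in the centre of the ball. -/
lemma measure_ball_eq_zero_iff (μ : Measure Plane) (c : Plane) (r : ℝ) :
    μ (Metric.ball c r) = 0 ↔ ∀ (k : ℕ) (s : ℚ), dist (TopologicalSpace.denseSeq Plane k) c + s ≤ r →
      μ (Metric.ball (TopologicalSpace.denseSeq Plane k) s) = 0 := by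
  constructor
  · intro h k s hks
    exact measure_mono_null (Metric.ball_subset_ball' (by rwa [add_comm])) h
  · intro h
    have hcover : Metric.ball c r ⊆ ⋃ (k : ℕ) (s : ℚ)
        (_ : dist (TopologicalSpace.denseSeq Plane k) c + s ≤ r),
        Metric.ball (TopologicalSpace.denseSeq Plane k) s := fun y hy => by
      have hδ : 0 < (r - dist y c) / 2 := half_pos (sub_pos.2 hy)
      obtain ⟨s, hs0, hs⟩ := exists_rat_btwn hδ
      obtain ⟨k, hk⟩ := (TopologicalSpace.denseRange_denseSeq Plane).exists_dist_lt y hs0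
      simp only [mem_iUnion]
      refine ⟨k, s, ?_, hk⟩
      have := dist_triangle (TopologicalSpace.denseSeq Plane k) y c
      rw [dist_comm _ y] at this
      linarith
    exact measure_mono_null hcover (measure_iUnion_null fun k => measure_iUnion_null fun s =>
      measure_iUnion_null fun hks => h k s hks)

lemma measurableSet_void_shifted_ball (r : ℝ) :
    MeasurableSet {p : Plane × Measure Plane | p.2 (Metric.ball (-p.1) r) = 0} := by
  have : {p : Plane × Measure Plane | p.2 (Metric.ball (-p.1) r) = 0} = ⋂ (k : ℕ) (s : ℚ),
      ({p | dist (TopologicalSpace.denseSeq Plane k) (-p.1) + s ≤ r}ᶜ ∪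
        {p | p.2 (Metric.ball (TopologicalSpace.denseSeq Plane k) s) = 0}) := by
    ext p
    simp only [mem_ofPred_eq, mem_iInter, mem_union, mem_compl_iff, ← imp_iff_not_or]
    exact measure_ball_eq_zero_iff _ _ _
  rw [this]
  refine MeasurableSet.iInter fun k => MeasurableSet.iInter fun s => MeasurableSet.union ?_ ?_
  · exact (measurableSet_le (by fun_prop) measurable_const).compl
  · exact ((Measure.measurable_coe measurableSet_ball).comp measurable_snd)
      (measurableSet_singleton 0)

lemma map_add_ball (μ : Measure Plane) (x : Plane) (r : ℝ) :
    μ.map (fun y => x + y) (Metric.ball 0 r) = μ (Metric.ball (-x) r) := by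
  rw [Measure.map_apply (by fun_prop) measurableSet_ball]
  congr 1
  ext y
  simp [dist_eq_norm, add_comm]

variable {Ω : Type*} [MeasurableSpace Ω] {Pr : Measure Ω} [IsProbabilityMeasure Pr]

/-- Given the parents, the first `n` clusters miss the disc independently of each other. -/
lemma measure_clusters_void {X : ℕ → Ω → Plane} {Ψ : ℕ → Ω → Measure Plane} {Λ : Measure Plane}
    [IsFiniteMeasure Λ] (hX : ∀ i, Measurable (X i)) (hΨ : ∀ i, IsPoissonProcess Pr (Ψ i) Λ)
    (hind : iIndepFun Ψ Pr) (hXΨ : IndepFun (fun ω i => X i ω) (fun ω i => Ψ i ω) Pr)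
    (r : ℝ) (n : ℕ) :
    Pr {ω | ∀ i < n, Ψ i ω (Metric.ball (-X i ω) r) = 0} =
      ∫⁻ ω, expNeg (∑ i ∈ Finset.range n, Λ (Metric.ball (-X i ω) r)) ∂Pr := by
  have hXm : Measurable fun ω i => X i ω := measurable_pi_lambda _ hX
  have hΨm : Measurable fun ω i => Ψ i ω := measurable_pi_lambda _ fun i => (hΨ i).measurable
  set D : Set ((ℕ → Plane) × (ℕ → Measure Plane)) :=
    {p | ∀ i < n, p.2 i (Metric.ball (-p.1 i) r) = 0} with hDdef
  have hD : MeasurableSet D := by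
    have : D = ⋂ (i : ℕ) (_ : i < n), {p | p.2 i (Metric.ball (-p.1 i) r) = 0} := by
      ext p; simp [hDdef]
    rw [this]
    refine MeasurableSet.iInter fun i => MeasurableSet.iInter fun _ => ?_
    have hm : Measurable fun p : (ℕ → Plane) × (ℕ → Measure Plane) => (p.1 i, p.2 i) :=
      ((measurable_pi_apply i).comp measurable_fst).prodMk
        ((measurable_pi_apply i).comp measurable_snd)
    exact hm (measurableSet_void_shifted_ball r)
  have hpre : {ω | ∀ i < n, Ψ i ω (Metric.ball (-X i ω) r) = 0} =
      (fun ω => ((fun i => X i ω), fun i => Ψ i ω)) ⁻¹' D := rfl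
  rw [hpre, ← Measure.map_apply (hXm.prodMk hΨm) hD,
    hXΨ.map_prod_eq_prod_map_map hXm.aemeasurable hΨm.aemeasurable, Measure.prod_apply hD,
    lintegral_map (measurable_measure_prodMk_left hD) hXm]
  refine lintegral_congr fun ω => ?_
  rw [Measure.map_apply hΨm (measurable_prodMk_left hD), expNeg_sum]
  have hset : (fun ω i => Ψ i ω) ⁻¹' (Prod.mk (fun i => X i ω) ⁻¹' D) =
      ⋂ i ∈ Finset.range n, Ψ i ⁻¹' {ψ | ψ (Metric.ball (-X i ω) r) = 0} := by
    ext ω'; simp [hDdef]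
  have hvoid : ∀ i, MeasurableSet {ψ : Measure Plane | ψ (Metric.ball (-X i ω) r) = 0} := fun i =>
    (Measure.measurable_coe measurableSet_ball) (measurableSet_singleton 0)
  rw [hset, hind.measure_inter_preimage_eq_mul _ fun i _ => hvoid i]
  exact Finset.prod_congr rfl fun i _ =>
    (hΨ i).measure_void measurableSet_ball (measure_ne_top _ _)

/-- The void probability of a Poisson cluster process: average over the clusters with the parents
fixed, then apply the Laplace functional of the parents. -/
lemma measure_cluster_process_void {Φ : Ω → Measure Plane} {X : ℕ → Ω → Plane}
    {Ψ : ℕ → Ω → Measure Plane} {Λ Λp : Measure Plane} [IsFiniteMeasure Λ] [SigmaFinite Λp]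
    (hX : ∀ i, Measurable (X i))
    (hp : IsPoissonProcess Pr (fun ω => Measure.sum fun i => Measure.dirac (X i ω)) Λp)
    (hΨ : ∀ i, IsPoissonProcess Pr (Ψ i) Λ) (hind : iIndepFun Ψ Pr)
    (hXΨ : IndepFun (fun ω i => X i ω) (fun ω i => Ψ i ω) Pr)
    (hΦ : ∀ᵐ ω ∂Pr, Φ ω = Measure.sum fun i => (Ψ i ω).map (fun y => X i ω + y)) (r : ℝ) :
    Pr {ω | Φ ω (Metric.ball 0 r) = 0} =
      expNeg (∫⁻ x, (1 - expNeg (Λ (Metric.ball (-x) r))) ∂Λp) := by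
  have hg : Measurable fun x => Λ (Metric.ball (-x) r) := by
    have hS : MeasurableSet {p : Plane × Plane | dist p.2 (-p.1) < r} :=
      measurableSet_lt (by fun_prop) measurable_const
    exact measurable_measure_prodMk_left hS
  have hall : Pr {ω | Φ ω (Metric.ball 0 r) = 0} =
      Pr (⋂ n : ℕ, {ω | ∀ i < n, Ψ i ω (Metric.ball (-X i ω) r) = 0}) := by
    refine measure_congr ?_
    filter_upwards [hΦ] with ω hω
    refine propext ?_
    change Φ ω (Metric.ball 0 r) = 0 ↔ ω ∈ ⋂ n : ℕ, _
    rw [hω, Measure.sum_apply _ measurableSet_ball]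
    simp_rw [map_add_ball]
    rw [ENNReal.tsum_eq_zero]
    simp only [mem_iInter, mem_ofPred_eq]
    exact ⟨fun h _ i _ => h i, fun h i => h (i + 1) i (Nat.lt_succ_self i)⟩
  have hmeas : ∀ n : ℕ, MeasurableSet {ω | ∀ i < n, Ψ i ω (Metric.ball (-X i ω) r) = 0} := by
    intro n
    have : {ω | ∀ i < n, Ψ i ω (Metric.ball (-X i ω) r) = 0} =
        ⋂ (i : ℕ) (_ : i < n), {ω | Ψ i ω (Metric.ball (-X i ω) r) = 0} := by ext; simp
    rw [this]
    exact MeasurableSet.iInter fun i => MeasurableSet.iInter fun _ =>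
      ((hX i).prodMk (hΨ i).measurable) (measurableSet_void_shifted_ball r)
  have hlim1 := tendsto_measure_iInter_atTop (μ := Pr) (fun n => (hmeas n).nullMeasurableSet)
    (fun m n hmn ω h i hi => h i (hi.trans_le hmn)) ⟨0, measure_ne_top _ _⟩
  have hlim2 : Tendsto (fun n : ℕ =>
      ∫⁻ ω, expNeg (∑ i ∈ Finset.range n, Λ (Metric.ball (-X i ω) r)) ∂Pr) atTop
      (𝓝 (∫⁻ ω, expNeg (∑' i, Λ (Metric.ball (-X i ω) r)) ∂Pr)) := by
    refine tendsto_lintegral_of_dominated_convergence (fun _ => 1) (fun n => ?_)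
      (fun n => ae_of_all _ fun ω => expNeg_le_one _) (by simp) (ae_of_all _ fun ω => ?_)
    · exact measurable_expNeg.comp (Finset.measurable_fun_sum _ fun i _ => hg.comp (hX i))
    · exact (continuous_expNeg.tendsto _).comp ENNReal.summable.hasSum.tendsto_sum_nat
  have hlap := hp.laplace hg
  simp_rw [lintegral_sum_measure, lintegral_dirac' _ hg] at hlap
  rw [hall, ← hlap]
  refine tendsto_nhds_unique hlim1 (hlim2.congr fun n => ?_)
  exact (measure_clusters_void hX hΨ hind hXΨ r n).symm

lemma sigmaFinite_ofReal_smul_volume (lam : ℝ) :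
    SigmaFinite (ENNReal.ofReal lam • (volume : Measure Plane)) := by
  have : ENNReal.ofReal lam • (volume : Measure Plane) = lam.toNNReal • volume := rfl
  rw [this]
  infer_instance

lemma setLIntegral_cluster_intensity {mbar : ℝ} (hmbar : 0 ≤ mbar) (σ : ℝ) (A : Set Plane) :
    ∫⁻ y in A, ENNReal.ofReal (mbar * displacementDensity σ y) =
      ENNReal.ofReal mbar * ∫⁻ y in A, ENNReal.ofReal (displacementDensity σ y) := by
  simp_rw [ENNReal.ofReal_mul hmbar]
  exact lintegral_const_mul _ (continuous_displacementDensity σ).measurable.ennreal_ofReal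

lemma isFiniteMeasure_cluster_intensity {mbar σ : ℝ} (hmbar : 0 ≤ mbar) (hσ : 0 < σ) :
    IsFiniteMeasure ((volume : Measure Plane).withDensity
      fun y => ENNReal.ofReal (mbar * displacementDensity σ y)) := by
  refine isFiniteMeasure_withDensity ?_
  rw [← setLIntegral_univ, setLIntegral_cluster_intensity hmbar, setLIntegral_univ,
    lintegral_displacementDensity hσ, mul_one]
  exact ENNReal.ofReal_ne_top

lemma cluster_intensity_ball {mbar σ r : ℝ} (hmbar : 0 ≤ mbar) (hσ : 0 < σ) (hr : 0 ≤ r)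
    (x : Plane) :
    (volume : Measure Plane).withDensity (fun y => ENNReal.ofReal (mbar * displacementDensity σ y))
      (Metric.ball (-x) r) = ENNReal.ofReal (mbar * discMass σ ‖x‖ r) := by
  rw [withDensity_apply _ measurableSet_ball, setLIntegral_cluster_intensity hmbar,
    setLIntegral_displacementDensity hσ,
    ← ofReal_integral_eq_lintegral_ofReal (continuous_radialDensity_right _ _).integrableOn_Ioc,
    ← intervalIntegral.integral_of_le hr, ← discMass, ← ENNReal.ofReal_mul hmbar]
  filter_upwards [ae_restrict_mem measurableSet_Ioc] with s hs
  exact radialDensity_nonneg hσ hs.1.le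

lemma lintegral_void_polar {lamp mbar σ r : ℝ} (hlamp : 0 ≤ lamp) (hmbar : 0 ≤ mbar)
    (hσ : 0 < σ) (hr : 0 ≤ r) :
    ∫⁻ x : Plane, (1 - expNeg (ENNReal.ofReal (mbar * discMass σ ‖x‖ r)))
      ∂(ENNReal.ofReal lamp • volume) =
    ∫⁻ z in Ioi (0 : ℝ), ENNReal.ofReal (2 * Real.pi * lamp * z *
        (1 - Real.exp (-mbar * discMass σ z r))) := by
  have hdm : Measurable fun z : ℝ => discMass σ z r :=
    (continuous_discMass_left σ r).measurable
  have hm : Measurable fun z : ℝ => 1 - expNeg (ENNReal.ofReal (mbar * discMass σ z r)) := by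
    fun_prop
  rw [lintegral_smul_measure, lintegral_comp_norm_plane hm, smul_eq_mul,
    ← lintegral_const_mul' _ _ ENNReal.ofReal_ne_top]
  refine setLIntegral_congr_fun measurableSet_Ioi fun z hz => ?_
  have hz' : 0 ≤ z := (mem_Ioi.1 hz).le
  have hd : 0 ≤ mbar * discMass σ z r := mul_nonneg hmbar (discMass_nonneg hσ hr)
  rw [expNeg_ofReal hd, ← ENNReal.ofReal_one, ← ENNReal.ofReal_sub _ (Real.exp_pos _).le,
    ← ENNReal.ofReal_mul (by positivity), ← ENNReal.ofReal_mul hlamp, neg_mul]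
  congr 1
  ring

/-- The void probability of a Thomas process, in polar coordinates for the parents. -/
lemma IsThomasProcess.measure_void {Φ : Ω → Measure Plane} {lamp mbar σ : ℝ} (hlamp : 0 ≤ lamp)
    (hmbar : 0 ≤ mbar) (hσ : 0 < σ) (h : IsThomasProcess Pr Φ lamp mbar σ) {r : ℝ} (hr : 0 ≤ r) :
    Pr {ω | Φ ω (Metric.ball 0 r) = 0} =
      expNeg (∫⁻ z in Ioi (0 : ℝ), ENNReal.ofReal (2 * Real.pi * lamp * z *
        (1 - Real.exp (-mbar * discMass σ z r)))) := by
  obtain ⟨X, Ψ, hX, hp, hΨ, hind, hXΨ, hΦ⟩ := h.exists_clusters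
  have hfin := isFiniteMeasure_cluster_intensity hmbar hσ
  have := sigmaFinite_ofReal_smul_volume lamp
  have hvoid := measure_cluster_process_void (Λp := ENNReal.ofReal lamp • volume) hX hp hΨ hind
    hXΨ hΦ r
  rw [hvoid, ← lintegral_void_polar hlamp hmbar hσ hr]
  exact congrArg expNeg (lintegral_congr fun x => by rw [cluster_intensity_ball hmbar hσ hr])

end

section

/-! ### The hazard rate of the contact distance of a Thomas process -/

/-- A survival function `exp (-∫₀ʳ h)` has density `h(s) exp (-∫₀ˢ h)`. -/
lemma integral_hazard {h : ℝ → ℝ} (hh : ContinuousOn h (Ici 0)) {a b : ℝ} (ha : 0 ≤ a)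
    (hab : a ≤ b) :
    ∫ s in a..b, h s * Real.exp (-∫ t in (0 : ℝ)..s, h t) =
      Real.exp (-∫ t in (0 : ℝ)..a, h t) - Real.exp (-∫ t in (0 : ℝ)..b, h t) := by
  -- extend `h` continuously to negative arguments, so that the primitive is differentiable at `0`
  set k : ℝ → ℝ := fun s => h (max s 0) with hk
  have hkc : Continuous k := hh.comp_continuous (by fun_prop) fun s => le_max_right s 0
  have hkeq : ∀ s, 0 ≤ s → ∫ t in (0 : ℝ)..s, h t = ∫ t in (0 : ℝ)..s, k t := fun s hs =>
    intervalIntegral.integral_congr fun t ht => by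
      rw [uIcc_of_le hs] at ht
      simp [hk, max_eq_left ht.1]
  have hd : ∀ s, HasDerivAt (fun s => -Real.exp (-∫ t in (0 : ℝ)..s, k t))
      (k s * Real.exp (-∫ t in (0 : ℝ)..s, k t)) s := fun s => by
    have := (hkc.integral_hasStrictDerivAt 0 s).hasDerivAt.neg.exp.neg
    exact this.congr_deriv (by simp only [Pi.neg_apply]; ring)
  have hprim : Continuous fun s => ∫ t in (0 : ℝ)..s, k t :=
    continuous_iff_continuousAt.2 fun s => (hkc.integral_hasStrictDerivAt 0 s).hasDerivAt.continuousAt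
  have hcongr : ∫ s in a..b, h s * Real.exp (-∫ t in (0 : ℝ)..s, h t) =
      ∫ s in a..b, k s * Real.exp (-∫ t in (0 : ℝ)..s, k t) :=
    intervalIntegral.integral_congr fun s hs => by
      rw [uIcc_of_le hab] at hs
      have hs0 := ha.trans hs.1
      simp only [hkeq s hs0]
      simp [hk, max_eq_left hs0]
  rw [hcongr, intervalIntegral.integral_eq_sub_of_hasDerivAt (fun s _ => hd s)
    ((hkc.mul (by fun_prop)).intervalIntegrable _ _), hkeq a ha, hkeq b (ha.trans hab)]
  ring

/-- The integrand of `τ₂`, for which `∫₀ʳ clusterKernel z s ds` is the integrand of the exponent of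
the void probability. -/
def clusterKernel (lamp mbar σ z s : ℝ) : ℝ :=
  2 * Real.pi * lamp * z * (mbar * radialDensity σ z s * Real.exp (-mbar * discMass σ z s))

lemma continuous_clusterKernel (lamp mbar σ : ℝ) :
    Continuous fun p : ℝ × ℝ => clusterKernel lamp mbar σ p.1 p.2 := by
  unfold clusterKernel
  exact (by fun_prop : Continuous fun p : ℝ × ℝ => 2 * Real.pi * lamp * p.1).mul
    ((continuous_const.mul (continuous_radialDensity σ)).mul
      (Real.continuous_exp.comp (continuous_const.mul (continuous_discMass σ))))

lemma clusterKernel_nonneg {lamp mbar σ z s : ℝ} (hlamp : 0 ≤ lamp) (hmbar : 0 ≤ mbar)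
    (hσ : 0 < σ) (hz : 0 ≤ z) (hs : 0 ≤ s) : 0 ≤ clusterKernel lamp mbar σ z s := by
  have := radialDensity_nonneg (z := z) hσ hs
  unfold clusterKernel
  positivity

lemma clusterKernel_pos {lamp mbar σ z s : ℝ} (hlamp : 0 < lamp) (hmbar : 0 < mbar)
    (hσ : 0 < σ) (hz : 0 < z) (hs : 0 < s) : 0 < clusterKernel lamp mbar σ z s := by
  have : 0 < radialDensity σ z s := div_pos (ricePdf_pos (div_pos hs hσ)) hσ
  unfold clusterKernel
  positivity

/-- A Gaussian majorant of `clusterKernel z s`, uniform for `s` in `[0, S]`. -/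
def clusterBound (lamp mbar σ S z : ℝ) : ℝ :=
  (2 * Real.pi * lamp * mbar * (S / σ / σ * Real.exp (S ^ 2 / (2 * σ ^ 2)))) *
    (z * Real.exp (-(1 / (4 * σ ^ 2)) * z ^ 2))

lemma clusterKernel_le {lamp mbar σ z s S : ℝ} (hlamp : 0 ≤ lamp) (hmbar : 0 ≤ mbar)
    (hσ : 0 < σ) (hz : 0 ≤ z) (hs : 0 ≤ s) (hS : s ≤ S) :
    clusterKernel lamp mbar σ z s ≤ clusterBound lamp mbar σ S z := by
  have h1 : radialDensity σ z s ≤ S / σ / σ * Real.exp (S ^ 2 / (2 * σ ^ 2)) *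
      Real.exp (-(1 / (4 * σ ^ 2)) * z ^ 2) := by
    have h2 := ricePdf_le (a := z / σ) (b := s / σ) (by positivity) (by positivity)
    have h3 : -(z / σ - s / σ) ^ 2 / 2 ≤ S ^ 2 / (2 * σ ^ 2) + -(1 / (4 * σ ^ 2)) * z ^ 2 := by
      have : S ^ 2 / (2 * σ ^ 2) + -(1 / (4 * σ ^ 2)) * z ^ 2 - -(z / σ - s / σ) ^ 2 / 2 =
          (2 * S ^ 2 - z ^ 2 + 2 * (z - s) ^ 2) / (4 * σ ^ 2) := by field_simp; ring
      have h4 : 0 ≤ (2 * S ^ 2 - z ^ 2 + 2 * (z - s) ^ 2) / (4 * σ ^ 2) :=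
        div_nonneg (by nlinarith [sq_nonneg (z - 2 * s)]) (by positivity)
      linarith
    have h5 : ricePdf (z / σ) (s / σ) ≤ S / σ *
        (Real.exp (S ^ 2 / (2 * σ ^ 2)) * Real.exp (-(1 / (4 * σ ^ 2)) * z ^ 2)) := by
      rw [← Real.exp_add]
      exact h2.trans (mul_le_mul (by gcongr) (Real.exp_le_exp.2 h3) (Real.exp_pos _).le
        (div_nonneg (hs.trans hS) hσ.le))
    calc radialDensity σ z s ≤ S / σ * (Real.exp (S ^ 2 / (2 * σ ^ 2)) *
          Real.exp (-(1 / (4 * σ ^ 2)) * z ^ 2)) / σ := div_le_div_of_nonneg_right h5 hσ.le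
      _ = _ := by ring
  have h6 : Real.exp (-mbar * discMass σ z s) ≤ 1 := by
    rw [Real.exp_le_one_iff]
    nlinarith [mul_nonneg hmbar (discMass_nonneg (z := z) hσ hs)]
  have hd := radialDensity_nonneg (z := z) hσ hs
  calc clusterKernel lamp mbar σ z s
      ≤ 2 * Real.pi * lamp * z * (mbar * radialDensity σ z s * 1) := by
        unfold clusterKernel
        gcongr
    _ ≤ 2 * Real.pi * lamp * z * (mbar * (S / σ / σ * Real.exp (S ^ 2 / (2 * σ ^ 2)) *
      Real.exp (-(1 / (4 * σ ^ 2)) * z ^ 2)) * 1) := by gcongr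
    _ = clusterBound lamp mbar σ S z := by unfold clusterBound; ring

lemma integrableOn_clusterBound (lamp mbar S : ℝ) {σ : ℝ} (hσ : 0 < σ) :
    IntegrableOn (clusterBound lamp mbar σ S) (Ioi 0) :=
  ((integrable_mul_exp_neg_mul_sq (by positivity)).const_mul _).integrableOn

lemma integrableOn_clusterKernel {lamp mbar σ s : ℝ} (hlamp : 0 ≤ lamp) (hmbar : 0 ≤ mbar)
    (hσ : 0 < σ) (hs : 0 ≤ s) :
    IntegrableOn (fun z => clusterKernel lamp mbar σ z s) (Ioi 0) := by
  refine (integrableOn_clusterBound lamp mbar s hσ).mono'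
    ((continuous_clusterKernel lamp mbar σ).comp
      (by fun_prop : Continuous fun z : ℝ => (z, s))).aestronglyMeasurable ?_
  · filter_upwards [ae_restrict_mem measurableSet_Ioi] with z hz
    have hz' : 0 ≤ z := (mem_Ioi.1 hz).le
    rw [Real.norm_of_nonneg (clusterKernel_nonneg hlamp hmbar hσ hz' hs)]
    exact clusterKernel_le hlamp hmbar hσ hz' hs le_rfl

lemma tau_two_eq {lam₁ lam₃ lamp mbar σ s : ℝ} (hσ : 0 < σ) (hs : 0 ≤ s) :
    tau lam₁ lam₃ lamp mbar σ Tier.two s = ∫ z in Ioi (0 : ℝ), clusterKernel lamp mbar σ z s := by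
  rw [tau, ← integral_const_mul]
  refine setIntegral_congr_fun measurableSet_Ioi fun z hz => ?_
  simp only [one_sub_marcumQ1_scaled hσ (mem_Ioi.1 hz).le hs, clusterKernel, radialDensity]
  ring

lemma continuousOn_tau_two {lam₁ lam₃ lamp mbar σ : ℝ} (hlamp : 0 ≤ lamp) (hmbar : 0 ≤ mbar)
    (hσ : 0 < σ) : ContinuousOn (tau lam₁ lam₃ lamp mbar σ Tier.two) (Ici 0) := by
  refine ContinuousOn.congr (f := fun s => ∫ z in Ioi (0 : ℝ), clusterKernel lamp mbar σ z s) ?_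
    fun s hs => tau_two_eq hσ hs
  intro s₀ hs₀
  have hev : ∀ᶠ s in 𝓝[Ici 0] s₀, 0 ≤ s ∧ s ≤ s₀ + 1 := by
    filter_upwards [self_mem_nhdsWithin,
      mem_nhdsWithin_of_mem_nhds (Iic_mem_nhds (lt_add_one s₀))] with s h1 h2 using ⟨h1, h2⟩
  refine continuousWithinAt_of_dominated (Eventually.of_forall fun s =>
      ((continuous_clusterKernel lamp mbar σ).comp
        (by fun_prop : Continuous fun z : ℝ => (z, s))).aestronglyMeasurable)
    (hev.mono fun s hs => ?_) (integrableOn_clusterBound lamp mbar (s₀ + 1) hσ)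
    (ae_of_all _ fun z => ((continuous_clusterKernel lamp mbar σ).comp
        (by fun_prop : Continuous fun s : ℝ => (z, s))).continuousWithinAt)
  filter_upwards [ae_restrict_mem measurableSet_Ioi] with z hz
  have hz' : 0 ≤ z := (mem_Ioi.1 hz).le
  rw [Real.norm_of_nonneg (clusterKernel_nonneg hlamp hmbar hσ hz' hs.1)]
  exact clusterKernel_le hlamp hmbar hσ hz' hs.1 hs.2

lemma tau_two_nonneg {lam₁ lam₃ lamp mbar σ s : ℝ} (hlamp : 0 ≤ lamp) (hmbar : 0 ≤ mbar)
    (hσ : 0 < σ) (hs : 0 ≤ s) : 0 ≤ tau lam₁ lam₃ lamp mbar σ Tier.two s := by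
  rw [tau_two_eq hσ hs]
  exact setIntegral_nonneg measurableSet_Ioi fun z hz =>
    clusterKernel_nonneg hlamp hmbar hσ (mem_Ioi.1 hz).le hs

lemma tau_two_pos {lam₁ lam₃ lamp mbar σ s : ℝ} (hlamp : 0 < lamp) (hmbar : 0 < mbar)
    (hσ : 0 < σ) (hs : 0 < s) : 0 < tau lam₁ lam₃ lamp mbar σ Tier.two s := by
  rw [tau_two_eq hσ hs.le, setIntegral_pos_iff_support_of_nonneg_ae]
  · refine lt_of_lt_of_le ?_ (measure_mono (s := Ioi (0 : ℝ)) fun z hz => ⟨?_, hz⟩)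
    · simp
    · exact (clusterKernel_pos hlamp hmbar hσ hz hs).ne'
  · filter_upwards [ae_restrict_mem measurableSet_Ioi] with z hz
    exact clusterKernel_nonneg hlamp.le hmbar.le hσ (mem_Ioi.1 hz).le hs.le
  · exact integrableOn_clusterKernel hlamp.le hmbar.le hσ hs.le

/-- The exponent of the void probability of the Thomas process is the cumulative hazard of `τ₂`:
differentiate in the radius under the integral over the parents. -/
lemma lintegral_void_exponent {lam₁ lam₃ lamp mbar σ r : ℝ} (hlamp : 0 ≤ lamp) (hmbar : 0 ≤ mbar)
    (hσ : 0 < σ) (hr : 0 ≤ r) :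
    ∫⁻ z in Ioi (0 : ℝ), ENNReal.ofReal (2 * Real.pi * lamp * z *
        (1 - Real.exp (-mbar * discMass σ z r))) =
      ENNReal.ofReal (∫ s in (0 : ℝ)..r, tau lam₁ lam₃ lamp mbar σ Tier.two s) := by
  have hinner : ∀ z ∈ Ioi (0 : ℝ), ENNReal.ofReal (2 * Real.pi * lamp * z *
        (1 - Real.exp (-mbar * discMass σ z r))) =
      ∫⁻ s in Ioc 0 r, ENNReal.ofReal (clusterKernel lamp mbar σ z s) := by
    intro z hz
    have hz' : 0 ≤ z := (mem_Ioi.1 hz).le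
    have hcont : Continuous fun s => clusterKernel lamp mbar σ z s :=
      (continuous_clusterKernel lamp mbar σ).comp (by fun_prop : Continuous fun s : ℝ => (z, s))
    have hz1 := integral_hazard (h := fun s => mbar * radialDensity σ z s)
      (continuous_const.mul (continuous_radialDensity_right σ z)).continuousOn le_rfl hr
    simp only [intervalIntegral.integral_const_mul, intervalIntegral.integral_same,
      neg_zero, Real.exp_zero, ← neg_mul] at hz1
    rw [← ofReal_integral_eq_lintegral_ofReal hcont.integrableOn_Ioc,
      ← intervalIntegral.integral_of_le hr]
    · simp only [clusterKernel, intervalIntegral.integral_const_mul]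
      simp only [discMass] at hz1 ⊢
      rw [hz1]
    · filter_upwards [ae_restrict_mem measurableSet_Ioc] with s hs
      exact clusterKernel_nonneg hlamp hmbar hσ hz' hs.1.le
  have houter : ∀ s ∈ Ioc 0 r, ∫⁻ z in Ioi (0 : ℝ), ENNReal.ofReal (clusterKernel lamp mbar σ z s) =
      ENNReal.ofReal (tau lam₁ lam₃ lamp mbar σ Tier.two s) := by
    intro s hs
    rw [tau_two_eq hσ hs.1.le, ofReal_integral_eq_lintegral_ofReal
      (integrableOn_clusterKernel hlamp hmbar hσ hs.1.le)]
    filter_upwards [ae_restrict_mem measurableSet_Ioi] with z hz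
    exact clusterKernel_nonneg hlamp hmbar hσ (mem_Ioi.1 hz).le hs.1.le
  rw [setLIntegral_congr_fun measurableSet_Ioi hinner, lintegral_lintegral_swap
      (continuous_clusterKernel lamp mbar σ).measurable.ennreal_ofReal.aemeasurable,
    setLIntegral_congr_fun measurableSet_Ioc houter, intervalIntegral.integral_of_le hr,
    ofReal_integral_eq_lintegral_ofReal]
  · exact ((continuousOn_tau_two hlamp hmbar hσ).mono Icc_subset_Ici_self).integrableOn_Icc.mono_set
      Ioc_subset_Icc_self
  · filter_upwards [ae_restrict_mem measurableSet_Ioc] with s hs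
    exact tau_two_nonneg hlamp hmbar hσ hs.1.le

lemma tcpVoid_eq {lam₁ lam₃ lamp mbar σ r : ℝ} (hlamp : 0 ≤ lamp) (hmbar : 0 ≤ mbar)
    (hσ : 0 < σ) (hr : 0 ≤ r) :
    tcpVoid lamp mbar σ r =
      Real.exp (-∫ s in (0 : ℝ)..r, tau lam₁ lam₃ lamp mbar σ Tier.two s) := by
  have hcongr : ∫ z in Ioi (0 : ℝ), 2 * Real.pi * lamp * z *
        (1 - Real.exp (-mbar * (1 - marcumQ1 (z / σ) (r / σ)))) =
      ∫ z in Ioi (0 : ℝ), 2 * Real.pi * lamp * z * (1 - Real.exp (-mbar * discMass σ z r)) :=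
    setIntegral_congr_fun measurableSet_Ioi fun z hz => by
      simp only [one_sub_marcumQ1_scaled hσ (mem_Ioi.1 hz).le hr]
  have hcont := continuous_discMass_left σ r
  rw [tcpVoid, hcongr, integral_eq_lintegral_of_nonneg_ae,
    lintegral_void_exponent (lam₁ := lam₁) (lam₃ := lam₃) hlamp hmbar hσ hr, ENNReal.toReal_ofReal]
  · exact intervalIntegral.integral_nonneg hr fun s hs => tau_two_nonneg hlamp hmbar hσ hs.1
  · filter_upwards [ae_restrict_mem measurableSet_Ioi] with z hz
    have hz' : 0 ≤ z := (mem_Ioi.1 hz).le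
    have h1 : Real.exp (-mbar * discMass σ z r) ≤ 1 := by
      rw [Real.exp_le_one_iff]
      nlinarith [mul_nonneg hmbar (discMass_nonneg (z := z) hσ hr)]
    have h2 := sub_nonneg.2 h1
    simp only [Pi.zero_apply]
    positivity
  · exact Continuous.aestronglyMeasurable (by fun_prop)

/-! ### Survival functions of the contact distances -/

variable {Ω : Type*} [MeasurableSpace Ω] {Pr : Measure Ω}

lemma IsHomogeneousPoisson.measure_le_contactDist {Φ : Ω → Measure Plane} {lam : ℝ}
    (hlam : 0 ≤ lam) (h : IsHomogeneousPoisson Pr Φ lam) {r : ℝ} (hr : 0 ≤ r) :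
    Pr {ω | ENNReal.ofReal r ≤ contactDist (Φ ω)} =
      ENNReal.ofReal (Real.exp (-∫ s in (0 : ℝ)..r, 2 * Real.pi * lam * s)) := by
  have hvol : (ENNReal.ofReal lam • (volume : Measure Plane)) (Metric.ball 0 r) =
      ENNReal.ofReal (∫ s in (0 : ℝ)..r, 2 * Real.pi * lam * s) := by
    rw [Measure.smul_apply, EuclideanSpace.volume_ball_fin_two, smul_eq_mul,
      ← ENNReal.ofReal_pow hr, ← ENNReal.ofReal_mul (by positivity), ← ENNReal.ofReal_mul hlam,
      intervalIntegral.integral_const_mul, integral_id]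
    congr 1
    ring
  simp_rw [(h.counting _).le_contactDist_iff]
  rw [IsPoissonProcess.measure_void h measurableSet_ball (by rw [hvol]; exact ENNReal.ofReal_ne_top),
    hvol, expNeg_ofReal]
  exact intervalIntegral.integral_nonneg hr fun s hs => mul_nonneg (by positivity) hs.1

lemma IsThomasProcess.measure_le_contactDist [IsProbabilityMeasure Pr] {Φ : Ω → Measure Plane}
    {lamp mbar σ : ℝ} (lam₁ lam₃ : ℝ) (hlamp : 0 ≤ lamp) (hmbar : 0 ≤ mbar) (hσ : 0 < σ)
    (h : IsThomasProcess Pr Φ lamp mbar σ) {r : ℝ} (hr : 0 ≤ r) :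
    Pr {ω | ENNReal.ofReal r ≤ contactDist (Φ ω)} = ENNReal.ofReal
      (Real.exp (-∫ s in (0 : ℝ)..r, tau lam₁ lam₃ lamp mbar σ Tier.two s)) := by
  simp_rw [(h.counting _).le_contactDist_iff]
  rw [h.measure_void hlamp hmbar hσ hr, lintegral_void_exponent hlamp hmbar hσ hr, expNeg_ofReal]
  exact intervalIntegral.integral_nonneg hr fun s hs => tau_two_nonneg hlamp hmbar hσ hs.1

end

section

/-! ### Competing distances with hazard rates -/

/-- `exp (-∫₀ˣ h)`, the survival function with hazard rate `h`. -/
def survival (h : ℝ → ℝ) (x : ℝ) : ℝ := Real.exp (-∫ s in (0 : ℝ)..x, h s)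

/-- The random distance `R`, which may be infinite, has hazard rate `h`: its survival function is
`exp (-∫₀ʳ h)`. The mass `exp (-∫₀^∞ h)` sits at `∞`. -/
structure HasHazardRate {Ω : Type*} [MeasurableSpace Ω] (Pr : Measure Ω) (R : Ω → ℝ≥0∞)
    (h : ℝ → ℝ) : Prop where
  measurable : Measurable R
  continuousOn : ContinuousOn h (Ici 0)
  nonneg : ∀ s, 0 ≤ s → 0 ≤ h s
  measure_le : ∀ r, 0 ≤ r → Pr {ω | ENNReal.ofReal r ≤ R ω} = ENNReal.ofReal (survival h r)

lemma survival_pos (h : ℝ → ℝ) (x : ℝ) : 0 < survival h x := Real.exp_pos _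

lemma continuousOn_survival {h : ℝ → ℝ} (hh : ContinuousOn h (Ici 0)) :
    ContinuousOn (survival h) (Ici 0) := by
  have hkc : Continuous fun s => h (max s 0) :=
    hh.comp_continuous (by fun_prop) fun s => le_max_right s 0
  have hprim : Continuous fun x => ∫ s in (0 : ℝ)..x, h (max s 0) :=
    continuous_iff_continuousAt.2 fun s => (hkc.integral_hasStrictDerivAt 0 s).hasDerivAt.continuousAt
  refine (Real.continuous_exp.comp hprim.neg).continuousOn.congr fun x hx => ?_
  simp only [survival, Function.comp_apply, Pi.neg_apply]
  congr 2
  refine intervalIntegral.integral_congr fun t ht => ?_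
  rw [uIcc_of_le hx] at ht
  simp [max_eq_left ht.1]

variable {Ω : Type*} [MeasurableSpace Ω] {Pr : Measure Ω}

namespace HasHazardRate

variable {R : Ω → ℝ≥0∞} {h : ℝ → ℝ}

lemma continuousOn_density (H : HasHazardRate Pr R h) :
    ContinuousOn (fun x => h x * survival h x) (Ici 0) :=
  H.continuousOn.mul (continuousOn_survival H.continuousOn)

lemma lintegral_density (H : HasHazardRate Pr R h) {a b : ℝ} (ha : 0 ≤ a) (hab : a ≤ b) :
    ∫⁻ x in Ioc a b, ENNReal.ofReal (h x * survival h x) =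
      ENNReal.ofReal (survival h a) - ENNReal.ofReal (survival h b) := by
  rw [← ofReal_integral_eq_lintegral_ofReal, ← intervalIntegral.integral_of_le hab,
    ← ENNReal.ofReal_sub _ (survival_pos _ _).le]
  · exact congrArg _ (integral_hazard H.continuousOn ha hab)
  · exact (H.continuousOn_density.mono fun x hx => ha.trans hx.1).integrableOn_Icc.mono_set
      Ioc_subset_Icc_self
  · filter_upwards [ae_restrict_mem measurableSet_Ioc] with s hs
    exact mul_nonneg (H.nonneg s (ha.trans hs.1.le)) (survival_pos _ _).le

variable [IsProbabilityMeasure Pr]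

/-- On the event that it is finite, the distance has density `h(x) exp (-∫₀ˣ h)`. -/
lemma map_toReal (H : HasHazardRate Pr R h) :
    (Pr.restrict {ω | R ω ≠ ∞}).map (fun ω => (R ω).toReal) =
      (volume.restrict (Ioi (0 : ℝ))).withDensity
        (fun x => ENNReal.ofReal (h x * survival h x)) := by
  refine Measure.ext_of_Ico _ _ fun a b hab => ?_
  have hfin : MeasurableSet {ω | R ω ≠ ∞} := (H.measurable (measurableSet_singleton ∞)).compl
  rw [Measure.map_apply H.measurable.ennreal_toReal measurableSet_Ico,
    Measure.restrict_apply (H.measurable.ennreal_toReal measurableSet_Ico),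
    withDensity_apply _ measurableSet_Ico, Measure.restrict_restrict measurableSet_Ico]
  rcases le_or_gt b 0 with hb | hb
  · have h1 : (fun ω => (R ω).toReal) ⁻¹' Ico a b ∩ {ω | R ω ≠ ∞} = ∅ := by
      refine eq_empty_of_forall_notMem fun ω hω => ?_
      exact absurd (hω.1.2.trans_le hb) (not_lt.2 ENNReal.toReal_nonneg)
    have h2 : Ico a b ∩ Ioi (0 : ℝ) = ∅ :=
      eq_empty_of_forall_notMem fun x hx => absurd (hx.1.2.trans_le hb) (not_lt.2 hx.2.le)
    rw [h1, h2]
    simp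
  · set a' := max a 0 with ha'
    have ha0 : 0 ≤ a' := le_max_right _ _
    have hab' : a' ≤ b := max_le hab.le hb.le
    have hset : (fun ω => (R ω).toReal) ⁻¹' Ico a b ∩ {ω | R ω ≠ ∞} =
        {ω | ENNReal.ofReal a' ≤ R ω} \ {ω | ENNReal.ofReal b ≤ R ω} := by
      ext ω
      simp only [mem_inter_iff, mem_preimage, mem_Ico, mem_ofPred_eq, Set.mem_sdiff, not_le]
      constructor
      · rintro ⟨⟨h1, h2⟩, h3⟩
        exact ⟨ENNReal.ofReal_le_of_le_toReal (max_le h1 ENNReal.toReal_nonneg),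
          (ENNReal.lt_ofReal_iff_toReal_lt h3).2 h2⟩
      · rintro ⟨h1, h2⟩
        have h3 : R ω ≠ ∞ := ne_top_of_lt h2
        exact ⟨⟨(le_max_left _ _).trans ((ENNReal.ofReal_le_iff_le_toReal h3).1 h1),
          (ENNReal.lt_ofReal_iff_toReal_lt h3).1 h2⟩, h3⟩
    have hae : (Ico a b ∩ Ioi 0 : Set ℝ) =ᵐ[volume] Ioc a' b := by
      rcases le_or_gt a 0 with ha | ha
      · have : Ico a b ∩ Ioi 0 = Ioo 0 b := by
          ext x
          simp only [mem_inter_iff, mem_Ico, mem_Ioi, mem_Ioo]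
          exact ⟨fun hx => ⟨hx.2, hx.1.2⟩, fun hx => ⟨⟨ha.trans hx.1.le, hx.2⟩, hx.1⟩⟩
        rw [this, ha', max_eq_right ha]
        exact Ioo_ae_eq_Ioc
      · have : Ico a b ∩ Ioi 0 = Ico a b :=
          inter_eq_left.2 fun x hx => ha.trans_le hx.1
        rw [this, ha', max_eq_left ha.le]
        exact Ico_ae_eq_Ioc
    rw [hset, measure_sdiff, H.measure_le a' ha0, H.measure_le b hb.le, setLIntegral_congr hae,
      H.lintegral_density ha0 hab']
    · exact fun ω hω => (ENNReal.ofReal_le_ofReal hab').trans hω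
    · exact (H.measurable measurableSet_Ici).nullMeasurableSet
    · exact measure_ne_top _ _

/-- A distance with a hazard rate has no finite atoms, so strictness of the inequality does not
matter. -/
lemma measure_lt (H : HasHazardRate Pr R h) {x : ℝ} (hx : 0 ≤ x) :
    Pr {ω | ENNReal.ofReal x < R ω} = ENNReal.ofReal (survival h x) := by
  have hatom : Pr {ω | R ω = ENNReal.ofReal x} = 0 := by
    have h1 := congrArg (fun μ => μ {x}) H.map_toReal
    beta_reduce at h1
    rw [Measure.map_apply H.measurable.ennreal_toReal (measurableSet_singleton x),
      Measure.restrict_apply (H.measurable.ennreal_toReal (measurableSet_singleton x)),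
      withDensity_apply _ (measurableSet_singleton x),
      Measure.restrict_restrict (measurableSet_singleton x), setLIntegral_measure_zero _ _
        (measure_mono_null inter_subset_left Real.volume_singleton)] at h1
    refine measure_mono_null (fun ω hω => ?_) h1
    have hω' : R ω = ENNReal.ofReal x := hω
    refine ⟨?_, ?_⟩
    · simp [hω', ENNReal.toReal_ofReal hx]
    · simp [hω']
  have hsplit : {ω | ENNReal.ofReal x ≤ R ω} =
      {ω | ENNReal.ofReal x < R ω} ∪ {ω | R ω = ENNReal.ofReal x} := by
    ext ω
    simp only [mem_ofPred_eq, mem_union, le_iff_lt_or_eq, eq_comm]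
  rw [← H.measure_le x hx, hsplit]
  refine le_antisymm (measure_mono subset_union_left) ((measure_union_le _ _).trans ?_)
  rw [hatom, add_zero]

end HasHazardRate

variable [IsProbabilityMeasure Pr]

/-- Among three independent distances with hazard rates, the joint law of `R₁` and the event that
the two others exceed fixed multiples of `R₁`: condition on `R₁`. -/
lemma measure_competing {R₁ R₂ R₃ : Ω → ℝ≥0∞} {h₁ h₂ h₃ : ℝ → ℝ} (H₁ : HasHazardRate Pr R₁ h₁)
    (H₂ : HasHazardRate Pr R₂ h₂) (H₃ : HasHazardRate Pr R₃ h₃)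
    (hind : IndepFun (fun ω => (R₂ ω, R₃ ω)) R₁ Pr) (hind' : IndepFun R₂ R₃ Pr)
    {c₂ c₃ : ℝ} (hc₂ : 0 < c₂) (hc₃ : 0 < c₃) {A : Set ℝ} (hA : MeasurableSet A) :
    Pr ({ω | ENNReal.ofReal c₂ * R₁ ω < R₂ ω ∧ ENNReal.ofReal c₃ * R₁ ω < R₃ ω} ∩
        (fun ω => (R₁ ω).toReal) ⁻¹' A) =
      ∫⁻ x in A, ENNReal.ofReal (h₁ x * survival h₁ x *
        (survival h₂ (c₂ * x) * survival h₃ (c₃ * x))) ∂(volume.restrict (Ioi 0)) := by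
  set E : Set ((ℝ≥0∞ × ℝ≥0∞) × ℝ≥0∞) := {p | (ENNReal.ofReal c₂ * p.2 < p.1.1 ∧
    ENNReal.ofReal c₃ * p.2 < p.1.2) ∧ p.2.toReal ∈ A} with hEdef
  have hE : MeasurableSet E := by
    have h2 : MeasurableSet {p : (ℝ≥0∞ × ℝ≥0∞) × ℝ≥0∞ | ENNReal.ofReal c₂ * p.2 < p.1.1} :=
      measurableSet_lt (by fun_prop) (by fun_prop)
    have h3 : MeasurableSet {p : (ℝ≥0∞ × ℝ≥0∞) × ℝ≥0∞ | ENNReal.ofReal c₃ * p.2 < p.1.2} :=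
      measurableSet_lt (by fun_prop) (by fun_prop)
    exact (h2.inter h3).inter (measurable_snd.ennreal_toReal hA)
  set G : ℝ → ℝ≥0∞ := fun x => Pr {ω | ENNReal.ofReal (c₂ * x) < R₂ ω} *
    Pr {ω | ENNReal.ofReal (c₃ * x) < R₃ ω} with hGdef
  -- survival probabilities are monotone in the radius, hence measurable
  have hanti : ∀ (R : Ω → ℝ≥0∞) {c : ℝ}, 0 < c →
      Measurable fun x => Pr {ω | ENNReal.ofReal (c * x) < R ω} := fun R c hc =>
    Antitone.measurable fun x y hxy => measure_mono fun ω hω =>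
      (ENNReal.ofReal_le_ofReal (mul_le_mul_of_nonneg_left hxy hc.le)).trans_lt hω
  have hG : Measurable G := (hanti R₂ hc₂).mul (hanti R₃ hc₃)
  have hfin : MeasurableSet {ω | R₁ ω ≠ ∞} := (H₁.measurable (measurableSet_singleton ∞)).compl
  have hinner : ∀ ω, Pr {ω' | ((R₂ ω', R₃ ω'), R₁ ω) ∈ E} =
      {ω | R₁ ω ≠ ∞}.indicator (fun ω => A.indicator G (R₁ ω).toReal) ω := by
    intro ω
    -- at `R₁ = ∞` the event is empty, so the atom of `R₁` at `∞` does not contribute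
    by_cases htop : R₁ ω = ∞
    · have h1 : {ω' | ((R₂ ω', R₃ ω'), R₁ ω) ∈ E} = ∅ := by
        refine eq_empty_of_forall_notMem fun ω' hω' => ?_
        have h2 : ENNReal.ofReal c₂ * R₁ ω < R₂ ω' := hω'.1.1
        rw [htop, ENNReal.mul_top (ENNReal.ofReal_pos.2 hc₂).ne'] at h2
        exact not_top_lt h2
      rw [h1, measure_empty, indicator_of_notMem (by simpa using htop)]
    rw [indicator_of_mem (show ω ∈ {ω | R₁ ω ≠ ∞} from htop)]
    by_cases hA' : (R₁ ω).toReal ∈ A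
    · rw [indicator_of_mem hA', hGdef]
      simp only [ENNReal.ofReal_mul hc₂.le, ENNReal.ofReal_mul hc₃.le, ENNReal.ofReal_toReal htop]
      refine Eq.trans ?_ (hind'.measure_inter_preimage_eq_mul (Ioi (ENNReal.ofReal c₂ * R₁ ω))
        (Ioi (ENNReal.ofReal c₃ * R₁ ω)) measurableSet_Ioi measurableSet_Ioi)
      congr 1
      ext ω'
      simp [hEdef, hA']
    · have h1 : {ω' | ((R₂ ω', R₃ ω'), R₁ ω) ∈ E} = ∅ :=
        eq_empty_of_forall_notMem fun ω' hω' => hA' hω'.2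
      rw [h1, measure_empty, indicator_of_notMem hA']
  have hpair : Measurable fun ω => (R₂ ω, R₃ ω) := H₂.measurable.prodMk H₃.measurable
  have hjoint : Pr ({ω | ENNReal.ofReal c₂ * R₁ ω < R₂ ω ∧ ENNReal.ofReal c₃ * R₁ ω < R₃ ω} ∩
        (fun ω => (R₁ ω).toReal) ⁻¹' A) = ∫⁻ ω, Pr {ω' | ((R₂ ω', R₃ ω'), R₁ ω) ∈ E} ∂Pr := by
    have hpre : {ω | ENNReal.ofReal c₂ * R₁ ω < R₂ ω ∧ ENNReal.ofReal c₃ * R₁ ω < R₃ ω} ∩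
        (fun ω => (R₁ ω).toReal) ⁻¹' A = (fun ω => ((R₂ ω, R₃ ω), R₁ ω)) ⁻¹' E := rfl
    rw [hpre, ← Measure.map_apply (hpair.prodMk H₁.measurable) hE,
      hind.map_prod_eq_prod_map_map hpair.aemeasurable H₁.measurable.aemeasurable,
      Measure.prod_apply_symm hE,
      lintegral_map (measurable_measure_prodMk_right hE) H₁.measurable]
    exact lintegral_congr fun ω => Measure.map_apply hpair (measurable_prodMk_right hE)
  have hdens : AEMeasurable (fun x => ENNReal.ofReal (h₁ x * survival h₁ x))
      (volume.restrict (Ioi 0)) :=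
    ((H₁.continuousOn_density.mono Ioi_subset_Ici_self).aemeasurable
      measurableSet_Ioi).ennreal_ofReal
  rw [hjoint]
  simp_rw [hinner]
  rw [lintegral_indicator hfin, ← lintegral_map (f := A.indicator G) (hG.indicator hA)
      H₁.measurable.ennreal_toReal, H₁.map_toReal,
    lintegral_withDensity_eq_lintegral_mul₀ hdens (hG.indicator hA).aemeasurable,
    ← lintegral_indicator hA]
  refine setLIntegral_congr_fun measurableSet_Ioi fun x hx => ?_
  have hx' : 0 ≤ x := (mem_Ioi.1 hx).le
  by_cases hxA : x ∈ A
  · simp only [Pi.mul_apply, indicator_of_mem hxA, hGdef]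
    rw [H₂.measure_lt (mul_nonneg hc₂.le hx'), H₃.measure_lt (mul_nonneg hc₃.le hx'),
      ← ENNReal.ofReal_mul (survival_pos _ _).le, ← ENNReal.ofReal_mul]
    exact mul_nonneg (H₁.nonneg x hx') (survival_pos _ _).le
  · simp [indicator_of_notMem hxA]

/-- Comparing received powers amounts to comparing distances, also at the distances `0` and `∞`. -/
lemma power_lt_power_iff {p q β : ℝ} (hp : 0 < p) (hq : 0 < q) (hβ : 0 < β) (x y : ℝ≥0∞) :
    ENNReal.ofReal p * x ^ (-β) < ENNReal.ofReal q * y ^ (-β) ↔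
      ENNReal.ofReal ((p / q) ^ (1 / β)) * y < x := by
  have hroot : ∀ {a : ℝ} (_ : 0 < a) (z : ℝ≥0∞), ENNReal.ofReal a * z ^ (-β) =
      (ENNReal.ofReal (a ^ (1 / β)) * z⁻¹) ^ β := fun {a} ha z => by
    rw [ENNReal.mul_rpow_of_nonneg _ _ hβ.le, ENNReal.inv_rpow, ENNReal.rpow_neg,
      ENNReal.ofReal_rpow_of_pos (Real.rpow_pos_of_pos ha _), ← Real.rpow_mul ha.le,
      one_div_mul_cancel hβ.ne', Real.rpow_one]
  have ha : 0 < p ^ (1 / β) := Real.rpow_pos_of_pos hp _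
  have hb : 0 < q ^ (1 / β) := Real.rpow_pos_of_pos hq _
  have hflip : ∀ {a : ℝ} (_ : 0 < a) (z : ℝ≥0∞),
      ENNReal.ofReal a * z⁻¹ = (ENNReal.ofReal a⁻¹ * z)⁻¹ := fun {a} ha z => by
    rw [ENNReal.mul_inv (Or.inl (by simpa using ha)) (Or.inl ENNReal.ofReal_ne_top),
      ENNReal.ofReal_inv_of_pos ha, inv_inv]
  rw [hroot hp, hroot hq, ENNReal.rpow_lt_rpow_iff hβ, hflip ha, hflip hb, ENNReal.inv_lt_inv,
    Real.div_rpow hp.le hq.le, div_eq_mul_inv (p ^ (1 / β)), ENNReal.ofReal_mul ha.le, mul_assoc,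
    ← ENNReal.mul_lt_mul_iff_right (a := ENNReal.ofReal (p ^ (1 / β)))
      (ENNReal.ofReal_pos.2 ha).ne' ENNReal.ofReal_ne_top,
    ← mul_assoc (ENNReal.ofReal (p ^ (1 / β))) (ENNReal.ofReal (p ^ (1 / β))⁻¹),
    ← ENNReal.ofReal_mul ha.le, mul_inv_cancel₀ ha.ne', ENNReal.ofReal_one, one_mul]

/-! ### The association event and the serving distance -/

lemma IsNetwork.hasHazardRate {Φ : Tier → Ω → Measure Plane} {lam₁ lam₃ lamp mbar σ : ℝ}
    (hΦ : IsNetwork Pr Φ lam₁ lam₃ lamp mbar σ) (hlam₁ : 0 ≤ lam₁) (hlam₃ : 0 ≤ lam₃)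
    (hlamp : 0 ≤ lamp) (hmbar : 0 ≤ mbar) (hσ : 0 < σ) (n : Tier) :
    HasHazardRate Pr (fun ω => contactDist (Φ n ω)) (tau lam₁ lam₃ lamp mbar σ n) := by
  cases n with
  | one =>
    exact ⟨(hΦ.isPointProcess _).measurable_contactDist,
      (by fun_prop : Continuous fun r : ℝ => 2 * Real.pi * lam₁ * r).continuousOn,
      fun s hs => show 0 ≤ 2 * Real.pi * lam₁ * s by positivity,
      fun r hr => hΦ.tier_one.measure_le_contactDist hlam₁ hr⟩
  | two =>
    exact ⟨(hΦ.isPointProcess _).measurable_contactDist,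
      continuousOn_tau_two hlamp hmbar hσ, fun s hs => tau_two_nonneg hlamp hmbar hσ hs,
      fun r hr => hΦ.tier_two.measure_le_contactDist lam₁ lam₃ hlamp hmbar hσ hr⟩
  | three =>
    exact ⟨(hΦ.isPointProcess _).measurable_contactDist,
      (by fun_prop : Continuous fun r : ℝ => 2 * Real.pi * lam₃ * r).continuousOn,
      fun s hs => show 0 ≤ 2 * Real.pi * lam₃ * s by positivity,
      fun r hr => hΦ.tier_three.measure_le_contactDist hlam₃ hr⟩

lemma tau_pos {lam₁ lam₃ lamp mbar σ : ℝ} (hlam₃ : 0 < lam₃) (hlamp : 0 < lamp) (hmbar : 0 < mbar)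
    (hσ : 0 < σ) {i : Tier} (hi : i = Tier.one → 0 < lam₁) {x : ℝ} (hx : 0 < x) :
    0 < tau lam₁ lam₃ lamp mbar σ i x := by
  cases i with
  | one => exact mul_pos (mul_pos (by positivity) (hi rfl)) hx
  | two => exact tau_two_pos hlamp hmbar hσ hx
  | three => exact mul_pos (mul_pos (by positivity) hlam₃) hx

lemma survival_linear (lam x : ℝ) :
    survival (fun r => 2 * Real.pi * lam * r) x = Real.exp (-Real.pi * lam * x ^ 2) := by
  rw [survival, intervalIntegral.integral_const_mul, integral_id]
  congr 1
  ring

/-- The claimed density is the hazard rate of the serving tier times the survival functions of all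
three tiers, each at its exclusion radius. -/
lemma servingDensity_eq {P : Tier → ℝ} (hP : ∀ i, 0 < P i) (β lam₁ lam₃ : ℝ) {lamp mbar σ : ℝ}
    (hlamp : 0 ≤ lamp) (hmbar : 0 ≤ mbar) (hσ : 0 < σ) (G : ℝ) (i : Tier) {x : ℝ} (hx : 0 ≤ x) :
    servingDensity P β lam₁ lam₃ lamp mbar σ G i x = G⁻¹ * (tau lam₁ lam₃ lamp mbar σ i x *
      (survival (tau lam₁ lam₃ lamp mbar σ Tier.one) ((P Tier.one / P i) ^ (1 / β) * x) *
      survival (tau lam₁ lam₃ lamp mbar σ Tier.two) ((P Tier.two / P i) ^ (1 / β) * x) *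
      survival (tau lam₁ lam₃ lamp mbar σ Tier.three) ((P Tier.three / P i) ^ (1 / β) * x))) := by
  have hsq : ∀ n, ((P n / P i) ^ (1 / β) * x) ^ 2 = (P n / P i) ^ (2 / β) * x ^ 2 := fun n => by
    rw [mul_pow, ← Real.rpow_natCast, ← Real.rpow_mul (div_pos (hP n) (hP i)).le]
    congr 2
    push_cast
    ring
  have h1 : survival (tau lam₁ lam₃ lamp mbar σ Tier.one) ((P Tier.one / P i) ^ (1 / β) * x) =
      Real.exp (-Real.pi * lam₁ * ((P Tier.one / P i) ^ (2 / β) * x ^ 2)) := by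
    rw [← hsq]; exact survival_linear _ _
  have h3 : survival (tau lam₁ lam₃ lamp mbar σ Tier.three) ((P Tier.three / P i) ^ (1 / β) * x) =
      Real.exp (-Real.pi * lam₃ * ((P Tier.three / P i) ^ (2 / β) * x ^ 2)) := by
    rw [← hsq]; exact survival_linear _ _
  have h2 : tcpVoid lamp mbar σ ((P Tier.two / P i) ^ (1 / β) * x) =
      survival (tau lam₁ lam₃ lamp mbar σ Tier.two) ((P Tier.two / P i) ^ (1 / β) * x) :=
    tcpVoid_eq hlamp hmbar hσ
      (mul_nonneg (Real.rpow_nonneg (div_pos (hP _) (hP i)).le _) hx)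
  rw [servingDensity, h1, h3, h2,
    show -Real.pi * (lam₁ * (P Tier.one / P i) ^ (2 / β) +
      lam₃ * (P Tier.three / P i) ^ (2 / β)) * x ^ 2 =
      -Real.pi * lam₁ * ((P Tier.one / P i) ^ (2 / β) * x ^ 2) +
      -Real.pi * lam₃ * ((P Tier.three / P i) ^ (2 / β) * x ^ 2) by ring, Real.exp_add]
  ring

lemma continuousOn_survival_comp {h : ℝ → ℝ} (hh : ContinuousOn h (Ici 0)) {c : ℝ} (hc : 0 ≤ c) :
    ContinuousOn (fun x => survival h (c * x)) (Ioi 0) :=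
  (continuousOn_survival hh).comp (by fun_prop) fun _ hx => mul_nonneg hc (mem_Ioi.1 hx).le

end

section

variable {Ω : Type*} [MeasurableSpace Ω] {Pr : Measure Ω} [IsProbabilityMeasure Pr]

lemma measurableSet_assocEvent {P : Tier → ℝ} {β : ℝ} {Φ : Tier → Ω → Measure Plane} {i j k : Tier}
    (hijk : ∀ n, n ≠ i ↔ n = j ∨ n = k)
    (hR : ∀ n, Measurable fun ω => contactDist (Φ n ω)) : MeasurableSet (assocEvent P β Φ i) := by
  have hpow : ∀ n, Measurable (maxPower P β Φ n) := fun n =>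
    ((hR n).pow_const (-β)).const_mul _
  have : assocEvent P β Φ i = {ω | maxPower P β Φ j ω < maxPower P β Φ i ω} ∩
      {ω | maxPower P β Φ k ω < maxPower P β Φ i ω} := by
    ext ω
    simp [assocEvent, hijk]
  rw [this]
  exact (measurableSet_lt (hpow j) (hpow i)).inter (measurableSet_lt (hpow k) (hpow i))

/-- Joint law of the serving distance and the association event, where `j` and `k` are the two tiers
other than `i`. -/
lemma measure_assocEvent_inter {P : Tier → ℝ} (hP : ∀ i, 0 < P i) {β : ℝ} (hβ : 0 < β)
    {Φ : Tier → Ω → Measure Plane} {h : Tier → ℝ → ℝ}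
    (hR : ∀ n, HasHazardRate Pr (fun ω => contactDist (Φ n ω)) (h n))
    (hind : iIndepFun (fun n ω => contactDist (Φ n ω)) Pr) {i j k : Tier}
    (hijk : ∀ n, n ≠ i ↔ n = j ∨ n = k) (hjk : j ≠ k) {A : Set ℝ} (hA : MeasurableSet A) :
    Pr (assocEvent P β Φ i ∩ (fun ω => (contactDist (Φ i ω)).toReal) ⁻¹' A) =
      ∫⁻ x in A, ENNReal.ofReal (h i x * survival (h i) x *
        (survival (h j) ((P j / P i) ^ (1 / β) * x) * survival (h k) ((P k / P i) ^ (1 / β) * x)))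
        ∂(volume.restrict (Ioi 0)) := by
  have hji : j ≠ i := (hijk j).2 (Or.inl rfl)
  have hki : k ≠ i := (hijk k).2 (Or.inr rfl)
  have hc : ∀ n, 0 < (P n / P i) ^ (1 / β) := fun n => Real.rpow_pos_of_pos (div_pos (hP n) (hP i)) _
  rw [← measure_competing (hR i) (hR j) (hR k)
    (hind.indepFun_prodMk (fun n => (hR n).measurable) j k i hji hki) (hind.indepFun hjk)
    (hc j) (hc k) hA]
  congr 2
  ext ω
  simp [assocEvent, maxPower, hijk, power_lt_power_iff (hP _) (hP i) hβ]

/-- The association event has positive probability, and the conditional law of the serving distance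
is the joint law divided by this probability. -/
lemma cond_assocEvent_map {P : Tier → ℝ} (hP : ∀ i, 0 < P i) {β : ℝ} (hβ : 0 < β)
    {Φ : Tier → Ω → Measure Plane} {h : Tier → ℝ → ℝ}
    (hR : ∀ n, HasHazardRate Pr (fun ω => contactDist (Φ n ω)) (h n))
    (hind : iIndepFun (fun n ω => contactDist (Φ n ω)) Pr) {i j k : Tier}
    (hijk : ∀ n, n ≠ i ↔ n = j ∨ n = k) (hjk : j ≠ k) (hpos : ∀ x, 0 < x → 0 < h i x) :
    0 < Pr (assocEvent P β Φ i) ∧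
    (Pr[|assocEvent P β Φ i]).map (fun ω => (contactDist (Φ i ω)).toReal) =
      (volume.restrict (Ioi (0 : ℝ))).withDensity fun x => ENNReal.ofReal
        ((Pr.real (assocEvent P β Φ i))⁻¹ * (h i x * survival (h i) x *
        (survival (h j) ((P j / P i) ^ (1 / β) * x) *
          survival (h k) ((P k / P i) ^ (1 / β) * x)))) := by
  set S := assocEvent P β Φ i
  set D : ℝ → ℝ := fun x => h i x * survival (h i) x *
    (survival (h j) ((P j / P i) ^ (1 / β) * x) * survival (h k) ((P k / P i) ^ (1 / β) * x))
    with hD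
  have hc : ∀ n, 0 ≤ (P n / P i) ^ (1 / β) := fun n =>
    Real.rpow_nonneg (div_pos (hP n) (hP i)).le _
  have hDm : AEMeasurable (fun x => ENNReal.ofReal (D x)) (volume.restrict (Ioi 0)) :=
    ((((hR i).continuousOn_density.mono Ioi_subset_Ici_self).mul
      ((continuousOn_survival_comp (hR j).continuousOn (hc j)).mul
      (continuousOn_survival_comp (hR k).continuousOn (hc k)))).aemeasurable
        measurableSet_Ioi).ennreal_ofReal
  have hDpos : ∀ x, 0 < x → 0 < D x := fun x hx =>
    mul_pos (mul_pos (hpos x hx) (survival_pos _ _)) (mul_pos (survival_pos _ _) (survival_pos _ _))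
  have hjoint : ∀ {A : Set ℝ}, MeasurableSet A →
      Pr (S ∩ (fun ω => (contactDist (Φ i ω)).toReal) ⁻¹' A) =
        ∫⁻ x in A, ENNReal.ofReal (D x) ∂(volume.restrict (Ioi 0)) := fun hA =>
    measure_assocEvent_inter hP hβ hR hind hijk hjk hA
  have hS : 0 < Pr S := by
    have h1 := hjoint MeasurableSet.univ
    rw [preimage_univ, inter_univ, setLIntegral_univ] at h1
    rw [h1, pos_iff_ne_zero, Ne, lintegral_eq_zero_iff' hDm]
    intro h0
    have h2 : ∀ᵐ _ ∂(volume.restrict (Ioi (0 : ℝ))), False := by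
      filter_upwards [h0, ae_restrict_mem measurableSet_Ioi] with x hx hx'
      exact (ENNReal.ofReal_pos.2 (hDpos x hx')).ne' hx
    simpa using ae_iff.1 h2
  refine ⟨hS, ?_⟩
  ext A hA
  have hSm := measurableSet_assocEvent (P := P) (β := β) hijk fun n => (hR n).measurable
  rw [Measure.map_apply (hR i).measurable.ennreal_toReal hA, cond_apply hSm, hjoint hA,
    withDensity_apply _ hA]
  have hinv : 0 < Pr.real S := ENNReal.toReal_pos hS.ne' (measure_ne_top _ _)
  simp_rw [ENNReal.ofReal_mul (inv_nonneg.2 hinv.le)]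
  rw [lintegral_const_mul' _ _ ENNReal.ofReal_ne_top, ENNReal.ofReal_inv_of_pos hinv,
    ofReal_measureReal]

end

end HetNet

end

theorem lemma2 {Ω : Type*} [MeasurableSpace Ω] (Pr : Measure Ω) [IsProbabilityMeasure Pr]
    (P : HetNet.Tier → ℝ) (hP : ∀ i, 0 < P i) (β : ℝ) (hβ : 0 < β)
    (lam₁ lam₃ lamp mbar σ : ℝ) (hlam₁ : 0 ≤ lam₁) (hlam₃ : 0 < lam₃) (hlamp : 0 < lamp)
    (hmbar : 0 < mbar) (hσ : 0 < σ)
    (Φ : HetNet.Tier → Ω → Measure HetNet.Plane)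
    (hΦ : HetNet.IsNetwork Pr Φ lam₁ lam₃ lamp mbar σ)
    (i : HetNet.Tier) (hi : i = HetNet.Tier.one → 0 < lam₁) :
    0 < Pr (HetNet.assocEvent P β Φ i) ∧
    (Pr[|HetNet.assocEvent P β Φ i]).map (fun ω => (HetNet.contactDist (Φ i ω)).toReal) =
      ((volume : Measure ℝ).restrict (Set.Ioi (0 : ℝ))).withDensity (fun x => ENNReal.ofReal
        (HetNet.servingDensity P β lam₁ lam₃ lamp mbar σ
          (Pr.real (HetNet.assocEvent P β Φ i)) i x)) := by
  open HetNet in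
  have hR := fun n => hΦ.hasHazardRate hlam₁ hlam₃.le hlamp.le hmbar.le hσ n
  -- `j` and `k` are the other two tiers; the exclusion radius of tier `i` itself is `x`
  have key : ∀ j k, (∀ n, n ≠ i ↔ n = j ∨ n = k) → j ≠ k →
      (∀ x, survival (tau lam₁ lam₃ lamp mbar σ i) x *
        (survival (tau lam₁ lam₃ lamp mbar σ j) ((P j / P i) ^ (1 / β) * x) *
        survival (tau lam₁ lam₃ lamp mbar σ k) ((P k / P i) ^ (1 / β) * x)) =
      survival (tau lam₁ lam₃ lamp mbar σ Tier.one) ((P Tier.one / P i) ^ (1 / β) * x) *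
      survival (tau lam₁ lam₃ lamp mbar σ Tier.two) ((P Tier.two / P i) ^ (1 / β) * x) *
      survival (tau lam₁ lam₃ lamp mbar σ Tier.three) ((P Tier.three / P i) ^ (1 / β) * x)) →
      0 < Pr (assocEvent P β Φ i) ∧
      (Pr[|assocEvent P β Φ i]).map (fun ω => (contactDist (Φ i ω)).toReal) =
        ((volume : Measure ℝ).restrict (Set.Ioi (0 : ℝ))).withDensity (fun x => ENNReal.ofReal
          (servingDensity P β lam₁ lam₃ lamp mbar σ
            (Pr.real (assocEvent P β Φ i)) i x)) := by
    intro j k hijk hjk hprod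
    obtain ⟨hS, hmap⟩ := cond_assocEvent_map hP hβ hR hΦ.iIndepFun_contactDist hijk hjk
      fun x hx => tau_pos hlam₃ hlamp hmbar hσ hi hx
    refine ⟨hS, hmap.trans (withDensity_congr_ae ?_)⟩
    filter_upwards [ae_restrict_mem measurableSet_Ioi] with x hx
    rw [servingDensity_eq hP β lam₁ lam₃ hlamp.le hmbar.le hσ _ i (Set.mem_Ioi.1 hx).le,
      ← hprod x, mul_assoc (tau _ _ _ _ _ i x)]
  have hone : ∀ x, (P i / P i) ^ (1 / β) * x = x := fun x => by
    rw [div_self (hP i).ne', Real.one_rpow, one_mul]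
  cases i with
  | one =>
    refine key Tier.two Tier.three (fun n => by cases n <;> simp) (by simp) fun x => ?_
    rw [hone]; ring
  | two =>
    refine key Tier.one Tier.three (fun n => by cases n <;> simp) (by simp) fun x => ?_
    rw [hone]; ring
  | three =>
    refine key Tier.one Tier.two (fun n => by cases n <;> simp) (by simp) fun x => ?_
    rw [hone]; ring
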